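/- Let $d_1, d_2, d_3, \dots$ be commuting variables (they stand for $d_i = \partial/\partial p_i$, so that a linear differential operator with constant coefficients in the variables $p_1, p_2, \dots$ is a polynomial in the $d_i$), and let $$S = \sum_{i \ge 1} i\, d_i \frac{\partial}{\partial d_{i+1}},$$ acting on polynomials in the $d_i$. For a Young diagram $\mu = (\mu_1 \ge \mu_2 \ge \cdots)$ with $d = |\mu|$ squares, let $\chi_\mu(\lambda)$ be the value of the character of the irreducible complex representation of $S_d$ assigned to $\mu$ on any permutation of cycle type $\lambda$ (with the convention that $\mu = (d)$ gives the trivial representation), and put $$D_\mu = \sum_{\lambda,\ |\lambda| = d} \chi_\mu(\lambda)\, \frac{d_{\lambda_1} \cdots d_{\lambda_k}}{|\mathrm{Aut}(\lambda)|},$$ where the sum is over the partitions $\lambda = (\lambda_1, \dots, \lambda_k)$ of $d$ and $|\mathrm{Aut}(\lambda)|$ is the number of permutations of the parts of $\lambda$ that preserve their values. A square of $\mu$ is a corner if erasing it leaves a Young diagram; a corner has coordinates $(i, \mu_i)$ for some $i \geq 1$, and $\mu - \square_i$ denotes the diagram obtained by erasing it. Then for every Young diagram $\mu$ $$S D_\mu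 = \sum_{(i,\mu_i)\ \text{corner of}\ \mu} (\mu_i - i)\, D_{\mu - \square_i}.$$ Equivalently, for every Young diagram $\mu$ with $d \ge 1$ squares and every partition $\lambda = (\lambda_1, \dots, \lambda_k)$ of $d-1$, $$\sum_{(i,\mu_i)\ \text{corner of}\ \mu} (\mu_i - i)\, \chi_{\mu - \square_i}(\lambda) = \sum_{i=1}^k \lambda_i\, \chi_\mu(\lambda + 1_i),$$ where $\lambda + 1_i$ is the partition of $d$ obtained from $\lambda$ by replacing $\lambda_i$ by $\lambda_i + 1$. -/

import Mathlib

noncomputable section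

namespace YoungHirota

/-! ### Irreducible characters of the symmetric groups

A Young diagram `μ` is Mathlib's `YoungDiagram`; its parts `μ₁ ≥ μ₂ ≥ ⋯` are the row lengths
`μ.rowLen 0 ≥ μ.rowLen 1 ≥ ⋯`, so the cell with 1-based coordinates `(i, j)` is `(i - 1, j - 1)`.
A tableau of shape `μ` with entries in `α` is a bijection `T : α ≃ μ.cells`. -/

section Specht

variable {α : Type*} [Fintype α] [DecidableEq α] {μ : YoungDiagram}

/-- The row symmetrizer of a tableau: the sum of the permutations of the entries that keep
every entry in its row. -/
def rowSymmetrizer (T : α ≃ μ.cells) : MonoidAlgebra ℂ (Equiv.Perm α) :=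
  ∑ σ : Equiv.Perm α with ∀ x, (T (σ x)).1.1 = (T x).1.1, MonoidAlgebra.single σ 1

/-- The column antisymmetrizer of a tableau: the signed sum of the permutations of the entries
that keep every entry in its column. -/
def colAntisymmetrizer (T : α ≃ μ.cells) : MonoidAlgebra ℂ (Equiv.Perm α) :=
  ∑ σ : Equiv.Perm α with ∀ x, (T (σ x)).1.2 = (T x).1.2,
    MonoidAlgebra.single σ ((Equiv.Perm.sign σ : ℤ) : ℂ)

/-- The Young symmetrizer of a tableau. -/
def youngSymmetrizer (T : α ≃ μ.cells) : MonoidAlgebra ℂ (Equiv.Perm α) :=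
  rowSymmetrizer T * colAntisymmetrizer T

/-- The Specht module: the left ideal of the group algebra generated by the Young symmetrizer. -/
abbrev spechtModule (T : α ≃ μ.cells) : Ideal (MonoidAlgebra ℂ (Equiv.Perm α)) :=
  Ideal.span {youngSymmetrizer T}

/-- The irreducible representation assigned to `μ`: permutations act on the Specht module by
left multiplication. -/
def spechtRep (T : α ≃ μ.cells) : Representation ℂ (Equiv.Perm α) (spechtModule T) :=
  Representation.ofModule' (spechtModule T)

end Specht

/-- The character `χ_μ` of the irreducible representation of the symmetric group `S_d`,
`d = |μ|`, assigned to `μ`. (Another tableau of shape `μ` gives an isomorphic representation.) -/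
def irrChar (μ : YoungDiagram) : Equiv.Perm (Fin μ.card) → ℂ :=
  (spechtRep (μ.cells.equivFin.symm : Fin μ.card ≃ μ.cells)).character

open Classical in
/-- `χ_μ(λ)`: the value of `χ_μ` at any permutation of cycle type `λ`, where `λ` is given by the
multiset of its parts (cycles of length 1 included). It is only used when `λ` is a partition of
`|μ|`; the value is `0` otherwise. -/
def charAt (μ : YoungDiagram) (l : Multiset ℕ) : ℂ :=
  if h : ∃ σ : Equiv.Perm (Fin μ.card), σ.partition.parts = l then irrChar μ h.choose else 0

/-- `χ_μ(λ)` does not depend on the permutation of cycle type `λ` that is used. -/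
theorem charAt_parts (μ : YoungDiagram) (σ : Equiv.Perm (Fin μ.card)) :
    charAt μ σ.partition.parts = irrChar μ σ := by
  have h : ∃ τ : Equiv.Perm (Fin μ.card), τ.partition.parts = σ.partition.parts := ⟨σ, rfl⟩
  have hc : IsConj σ h.choose :=
    Equiv.Perm.partition_eq_of_isConj.2 (Nat.Partition.ext h.choose_spec.symm)
  obtain ⟨c, hc⟩ := isConj_iff.1 hc
  rw [charAt, dif_pos h, ← hc]
  exact Representation.char_conj _ _ _

/-! ### The operators `D_μ` and `S`

Differential operators with constant coefficients are polynomials in the variables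
`d_i = ∂/∂p_i`, `i ≥ 1`; here `d_i` is `MvPolynomial.X i`, and `X 0` is never used. -/

/-- The number `|Aut(λ)|` of permutations of the parts of `λ` that preserve their values. -/
def autCard (l : Multiset ℕ) : ℕ := ∏ i ∈ l.toFinset, Nat.factorial (l.count i)

/-- `D_μ = ∑_{|λ| = d} χ_μ(λ) d_{λ₁} ⋯ d_{λ_k} / |Aut(λ)|`, where `d = |μ|`. -/
def D (μ : YoungDiagram) : MvPolynomial ℕ ℂ :=
  ∑ l : μ.card.Partition,
    MvPolynomial.C (charAt μ l.parts / (autCard l.parts : ℂ)) *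
      (l.parts.map fun i => (MvPolynomial.X i : MvPolynomial ℕ ℂ)).prod

/-- `S = ∑_{i ≥ 1} i d_i ∂/∂d_{i+1}`. The term for `i = 0` is zero, and on a given polynomial
only finitely many terms are nonzero. -/
def S (P : MvPolynomial ℕ ℂ) : MvPolynomial ℕ ℂ :=
  ∑ᶠ i : ℕ, MvPolynomial.C (i : ℂ) * MvPolynomial.X i * MvPolynomial.pderiv (i + 1) P

/-- The sum that defines `S` is a finite sum on every polynomial. -/
theorem S_support_finite (P : MvPolynomial ℕ ℂ) :
    (Function.support fun i : ℕ =>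
      MvPolynomial.C (i : ℂ) * MvPolynomial.X i * MvPolynomial.pderiv (i + 1) P).Finite := by
  refine Set.Finite.subset (P.vars.finite_toSet.preimage
    (f := fun i : ℕ => i + 1) (add_left_injective 1).injOn) fun i hi => ?_
  by_contra hv
  exact hi (by simp [MvPolynomial.pderiv_eq_zero_of_notMem_vars (i := i + 1) (f := P) hv])

/-! ### Corners -/

open Classical in
/-- The corners of `μ`: the cells which, when erased, leave a Young diagram. -/
def corners (μ : YoungDiagram) : Finset (ℕ × ℕ) :=
  {c ∈ μ.cells | IsLowerSet (↑(μ.cells.erase c) : Set (ℕ × ℕ))}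

theorem mem_corners {μ : YoungDiagram} {c : ℕ × ℕ} :
    c ∈ corners μ ↔ c ∈ μ.cells ∧ IsLowerSet (↑(μ.cells.erase c) : Set (ℕ × ℕ)) := by
  simp [corners]

/-- The diagram obtained from `μ` by erasing a corner. -/
def eraseCorner (μ : YoungDiagram) (c : corners μ) : YoungDiagram where
  cells := μ.cells.erase c.1
  isLowerSet := (mem_corners.1 c.2).2

end YoungHirota

end

noncomputable section

namespace YoungHirota

open Finset MonoidAlgebra Equiv.Perm

/-! The character identity is a Jucys–Murphy computation. Let `S_n` be the stabilizer of a point in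
`S_{n+1}`, and let `J` be the sum of the `n` transpositions that move this point. The sum of all
transpositions is central and acts on the Specht ideal of `μ` by the sum of the contents of `μ`
(`swapSum_mul_youngIdempotent`), and `J` is the difference of these sums for `S_{n+1}` and `S_n`.
Since `χ_μ` restricts to the sum of the `χ_{μ - □}` over the corners (`branchingRule`), the trace of
`J σ` is the sum of the `χ_{μ - □}(σ)` weighted by the contents `μ_i - i` of the corners
(`sum_content_mul_charAt`). On the other hand, a transposition in `J` inserts the extra point into
one cycle of `σ` (`parts_swap_mul`), and a cycle of length `λ_i` is hit `λ_i` times. This gives the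
right-hand side. The identity for `S` is the same statement coefficient by coefficient
(`sum_count_div_autCard`).

The branching rule is obtained by counting norms. A Specht character is the trace of `x ↦ g x e` for
an idempotent `e`, so inner products of characters are dimensions of spaces `a ℂ[G] e`
(`sum_idemChar_mul_idemChar`). With the row and column combinatorics of tableaux this makes the
characters orthonormal, and there are as many of them as partitions, so they form a basis of the
class functions. By induction, the character induced from `χ_ν` has norm `1 + #(corners ν)`
(`sum_classForm_sq`). Its multiplicities are natural numbers, positive on at least that many
diagrams, so they are all `0` or `1` (`classForm_restrict`). -/

theorem sum_fst_le_of_colLen (μ : YoungDiagram) (P : Finset (ℕ × ℕ))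
    (hP : ∀ j, #{p ∈ P | p.2 = j} = μ.colLen j) :
    ∑ p ∈ μ.cells, p.1 ≤ ∑ p ∈ P, p.1 ∧
      (∑ p ∈ P, p.1 ≤ ∑ p ∈ μ.cells, p.1 → P = μ.cells) := by
  have hmap : P.val.map Prod.snd = μ.cells.val.map Prod.snd := by
    ext j
    rw [Multiset.count_map, Multiset.count_map]
    have h1 := hP j
    rw [μ.colLen_eq_card, YoungDiagram.col] at h1
    simpa [Finset.card, eq_comm] using h1
  have hc : ∑ p ∈ P, (μ.colLen p.2 : ℤ) = ∑ p ∈ μ.cells, (μ.colLen p.2 : ℤ) := by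
    have := congrArg (fun s => (s.map fun j => (μ.colLen j : ℤ)).sum) hmap
    simpa [Multiset.map_map] using this
  have hcard : #P = #μ.cells := by simpa using congrArg Multiset.card hmap
  -- This weight is negative exactly on the cells of `μ`, so among all finite sets its sum is
  -- smallest on `μ`, and only there if the cardinality is that of `μ`. The `colLen` part has the
  -- same sum over `P` and over `μ`, so it drops out of the comparison.
  set g : ℕ × ℕ → ℤ := fun p => (p.1 : ℤ) - μ.colLen p.2 with hg
  have hneg : ∀ p ∈ μ.cells, g p < 0 := by
    rintro ⟨i, j⟩ hp
    have := YoungDiagram.mem_iff_lt_colLen.1 hp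
    simp only [hg]; lia
  have hnn : ∀ p ∉ μ.cells, 0 ≤ g p := by
    rintro ⟨i, j⟩ hp
    have := mt YoungDiagram.mem_iff_lt_colLen.2 hp
    simp only [hg]; lia
  have h1 : ∑ p ∈ P ∩ μ.cells, g p ≤ ∑ p ∈ P, g p := by
    refine sum_le_sum_of_subset_of_nonneg inter_subset_left fun p hp hp' => hnn p ?_
    simpa [hp] using hp'
  have h2 : ∑ p ∈ P ∩ μ.cells, g p + ∑ p ∈ μ.cells \ P, g p = ∑ p ∈ μ.cells, g p := by
    rw [inter_comm]
    exact sum_inter_add_sum_sdiff _ _ _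
  have h3 : ∑ p ∈ P, g p - ∑ p ∈ μ.cells, g p = ∑ p ∈ P, (p.1 : ℤ) - ∑ p ∈ μ.cells, (p.1 : ℤ) := by
    simp only [hg, sum_sub_distrib, hc]; ring
  have h4 : ∑ p ∈ μ.cells \ P, g p ≤ 0 :=
    sum_nonpos fun p hp => (hneg p (mem_sdiff.1 hp).1).le
  refine ⟨by zify; linarith, fun h => ?_⟩
  zify at h
  by_contra hne
  have hne' : (μ.cells \ P).Nonempty := by
    rw [sdiff_nonempty]
    exact fun hs => hne (eq_of_subset_of_card_le hs hcard.le).symm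
  have : ∑ p ∈ μ.cells \ P, g p < 0 :=
    sum_neg (fun p hp => hneg p (mem_sdiff.1 hp).1) hne'
  linarith

/-! ### Rows of one tableau against columns of another -/

section
variable {α : Type*} [Fintype α] [DecidableEq α] {lam μ : YoungDiagram}

theorem card_filter_col (T : α ≃ μ.cells) (j : ℕ) :
    #{x | (T x).1.2 = j} = μ.colLen j := by
  rw [μ.colLen_eq_card]
  refine card_bij (fun x _ => (T x).1) ?_ ?_ ?_
  · intro x hx; simp at hx; simp [YoungDiagram.mem_col_iff, hx]
  · intro x _ y _ h; exact T.injective (Subtype.ext h)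
  · intro c hc
    rw [YoungDiagram.mem_col_iff] at hc
    exact ⟨T.symm ⟨c, hc.1⟩, by simp [hc.2], by simp⟩

theorem card_filter_row (T : α ≃ μ.cells) (i : ℕ) :
    #{x | (T x).1.1 = i} = μ.rowLen i := by
  rw [μ.rowLen_eq_card]
  refine card_bij (fun x _ => (T x).1) ?_ ?_ ?_
  · intro x hx; simp at hx; simp [YoungDiagram.mem_row_iff, hx]
  · intro x _ y _ h; exact T.injective (Subtype.ext h)
  · intro c hc
    rw [YoungDiagram.mem_row_iff] at hc
    exact ⟨T.symm ⟨c, hc.1⟩, by simp [hc.2], by simp⟩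

theorem sum_tableau {M : Type*} [AddCommMonoid M] (T : α ≃ μ.cells) (f : ℕ × ℕ → M) :
    ∑ x, f (T x).1 = ∑ p ∈ μ.cells, f p := by
  rw [← sum_coe_sort μ.cells, ← T.sum_comp]

/-- If no two entries lie in the same row of `T` and in the same column of `U`, then the shapes
are comparable. -/
theorem sum_fst_le_of_injective (T : α ≃ lam.cells) (U : α ≃ μ.cells)
    (h : Function.Injective fun x => ((T x).1.1, (U x).1.2)) :
    ∑ p ∈ μ.cells, p.1 ≤ ∑ p ∈ lam.cells, p.1 ∧
      (∑ p ∈ lam.cells, p.1 ≤ ∑ p ∈ μ.cells, p.1 →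
        univ.image (fun x => ((T x).1.1, (U x).1.2)) = μ.cells) := by
  have := sum_fst_le_of_colLen μ (univ.image fun x => ((T x).1.1, (U x).1.2)) fun j => by
    rw [filter_image, card_image_of_injective _ h, ← card_filter_col U]
  rw [sum_image h.injOn, sum_tableau T (fun p => p.1)] at this
  exact this

theorem eq_of_forall_rowLen {lam μ : YoungDiagram} (h : ∀ i, lam.rowLen i = μ.rowLen i) : lam = μ := by
  ext ⟨i, j⟩
  rw [YoungDiagram.mem_cells, YoungDiagram.mem_cells, YoungDiagram.mem_iff_lt_rowLen,
    YoungDiagram.mem_iff_lt_rowLen, h]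

theorem eq_of_image_eq (T : α ≃ lam.cells) (U : α ≃ μ.cells)
    (h : Function.Injective fun x => ((T x).1.1, (U x).1.2))
    (hi : univ.image (fun x => ((T x).1.1, (U x).1.2)) = μ.cells) : lam = μ := by
  refine eq_of_forall_rowLen fun i => ?_
  rw [← card_filter_row T, μ.rowLen_eq_card, YoungDiagram.row, ← hi, filter_image,
    card_image_of_injective _ h]

/-- Two tableaux of different shapes: in one of the two orders there are two entries in the same
row of the one and in the same column of the other. -/
theorem exists_pair_of_ne (h : lam ≠ μ) :
    (∀ (T : α ≃ lam.cells) (U : α ≃ μ.cells),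
      ∃ x y, x ≠ y ∧ (T x).1.1 = (T y).1.1 ∧ (U x).1.2 = (U y).1.2) ∨
    (∀ (T : α ≃ lam.cells) (U : α ≃ μ.cells),
      ∃ x y, x ≠ y ∧ (T x).1.2 = (T y).1.2 ∧ (U x).1.1 = (U y).1.1) := by
  -- The sum of the row indices replaces the dominance order: it is a total comparison, and a tie is
  -- excluded because it would force equal shapes.
  rcases lt_or_ge (∑ p ∈ lam.cells, p.1) (∑ p ∈ μ.cells, p.1) with hlt | hle
  · left
    intro T U
    by_contra! hc
    refine absurd (sum_fst_le_of_injective T U fun x y hxy => ?_).1 hlt.not_ge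
    simp only [Prod.mk.injEq] at hxy
    by_contra hne
    exact hc x y hne hxy.1 hxy.2
  · right
    intro T U
    by_contra! hc
    have hinj : Function.Injective fun x => ((U x).1.1, (T x).1.2) := fun x y hxy => by
      simp only [Prod.mk.injEq] at hxy
      by_contra hne
      exact hc x y hne hxy.2 hxy.1
    have h1 := sum_fst_le_of_injective U T hinj
    by_cases hge : ∑ p ∈ μ.cells, p.1 ≤ ∑ p ∈ lam.cells, p.1
    · exact h (eq_of_image_eq U T hinj (h1.2 hge)).symm
    · exact hge hle

/-! ### Young symmetrizers -/


/-- The tableau with the entries permuted by `g`. -/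
abbrev permTableau (g : Equiv.Perm α) (T : α ≃ μ.cells) : α ≃ μ.cells := g.symm.trans T

theorem single_mul_colAntisymmetrizer (T : α ≃ μ.cells) (g : Equiv.Perm α) :
    single g 1 * colAntisymmetrizer T =
      colAntisymmetrizer (permTableau g T) * single g 1 := by
  simp only [colAntisymmetrizer, mul_sum, sum_mul, single_mul_single, one_mul, mul_one]
  refine sum_bij' (fun σ _ => g * σ * g⁻¹) (fun σ _ => g⁻¹ * σ * g) ?_ ?_ ?_ ?_ ?_
  · intro σ hσ
    simp only [mem_filter, mem_univ, true_and] at hσ ⊢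
    intro x
    simpa using hσ (g.symm x)
  · intro σ hσ
    simp only [mem_filter, mem_univ, true_and] at hσ ⊢
    intro x
    simpa using hσ (g x)
  · intro σ _; group
  · intro σ _; group
  · intro σ _
    rcases Int.units_eq_one_or (Equiv.Perm.sign g) with h | h <;> simp [h, mul_assoc]

theorem single_mul_rowSymmetrizer (T : α ≃ μ.cells) (g : Equiv.Perm α) :
    single g 1 * rowSymmetrizer T =
      rowSymmetrizer (permTableau g T) * single g 1 := by
  simp only [rowSymmetrizer, mul_sum, sum_mul, single_mul_single, one_mul]
  refine sum_bij' (fun σ _ => g * σ * g⁻¹) (fun σ _ => g⁻¹ * σ * g) ?_ ?_ ?_ ?_ ?_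
  · intro σ hσ
    simp only [mem_filter, mem_univ, true_and] at hσ ⊢
    intro x
    simpa using hσ (g.symm x)
  · intro σ hσ
    simp only [mem_filter, mem_univ, true_and] at hσ ⊢
    intro x
    simpa using hσ (g x)
  · intro σ _; group
  · intro σ _; group
  · intro σ _
    simp [mul_assoc]

theorem single_mul_rowSymmetrizer_of_row (T : α ≃ μ.cells) {g : Equiv.Perm α}
    (hg : ∀ x, (T (g x)).1.1 = (T x).1.1) :
    single g 1 * rowSymmetrizer T = rowSymmetrizer T := by
  simp only [rowSymmetrizer, mul_sum, single_mul_single, one_mul]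
  refine sum_bij' (fun σ _ => g * σ) (fun σ _ => g⁻¹ * σ) ?_ ?_ ?_ ?_ ?_
  · intro σ hσ
    simp only [mem_filter, mem_univ, true_and] at hσ ⊢
    intro x; simp [hg, hσ]
  · intro σ hσ
    simp only [mem_filter, mem_univ, true_and] at hσ ⊢
    intro x
    rw [← hσ x, ← hg]; simp
  · intro σ _; group
  · intro σ _; group
  · intro σ _; rfl

theorem rowSymmetrizer_mul_single (T : α ≃ μ.cells) {g : Equiv.Perm α}
    (hg : ∀ x, (T (g x)).1.1 = (T x).1.1) :
    rowSymmetrizer T * single g 1 = rowSymmetrizer T := by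
  simp only [rowSymmetrizer, sum_mul, single_mul_single, one_mul]
  refine sum_bij' (fun σ _ => σ * g) (fun σ _ => σ * g⁻¹) ?_ ?_ ?_ ?_ ?_
  · intro σ hσ
    simp only [mem_filter, mem_univ, true_and] at hσ ⊢
    intro x; simp [hg, hσ]
  · intro σ hσ
    simp only [mem_filter, mem_univ, true_and] at hσ ⊢
    intro x
    have := hg (g⁻¹ x)
    rw [← Equiv.Perm.mul_apply, mul_inv_cancel, Equiv.Perm.one_apply] at this
    simp [hσ, this]
  · intro σ _; group
  · intro σ _; group
  · intro σ _; rfl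

theorem single_mul_colAntisymmetrizer_of_col (T : α ≃ μ.cells) {g : Equiv.Perm α}
    (hg : ∀ x, (T (g x)).1.2 = (T x).1.2) :
    single g 1 * colAntisymmetrizer T =
      ((Equiv.Perm.sign g : ℤ) : ℂ) • colAntisymmetrizer T := by
  simp only [colAntisymmetrizer, mul_sum, single_mul_single, one_mul, smul_sum, smul_single]
  refine sum_bij' (fun σ _ => g * σ) (fun σ _ => g⁻¹ * σ) ?_ ?_ ?_ ?_ ?_
  · intro σ hσ
    simp only [mem_filter, mem_univ, true_and] at hσ ⊢
    intro x; simp [hg, hσ]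
  · intro σ hσ
    simp only [mem_filter, mem_univ, true_and] at hσ ⊢
    intro x
    rw [← hσ x, ← hg]; simp
  · intro σ _; group
  · intro σ _; group
  · intro σ _
    rcases Int.units_eq_one_or (Equiv.Perm.sign g) with h | h <;> simp [h]

theorem colAntisymmetrizer_mul_single (T : α ≃ μ.cells) {g : Equiv.Perm α}
    (hg : ∀ x, (T (g x)).1.2 = (T x).1.2) :
    colAntisymmetrizer T * single g 1 =
      ((Equiv.Perm.sign g : ℤ) : ℂ) • colAntisymmetrizer T := by
  simp only [colAntisymmetrizer, sum_mul, single_mul_single, mul_one, smul_sum, smul_single]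
  refine sum_bij' (fun σ _ => σ * g) (fun σ _ => σ * g⁻¹) ?_ ?_ ?_ ?_ ?_
  · intro σ hσ
    simp only [mem_filter, mem_univ, true_and] at hσ ⊢
    intro x; simp [hg, hσ]
  · intro σ hσ
    simp only [mem_filter, mem_univ, true_and] at hσ ⊢
    intro x
    have := hg (g⁻¹ x)
    rw [← Equiv.Perm.mul_apply, mul_inv_cancel, Equiv.Perm.one_apply] at this
    simp [hσ, this]
  · intro σ _; group
  · intro σ _; group
  · intro σ _
    rcases Int.units_eq_one_or (Equiv.Perm.sign g) with h | h <;> simp [h]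

theorem swap_row (T : α ≃ μ.cells) {x y : α} (h : (T x).1.1 = (T y).1.1) (z : α) :
    (T (Equiv.swap x y z)).1.1 = (T z).1.1 := by
  rw [Equiv.swap_apply_def]; split_ifs with h1 h2 <;> simp_all

theorem swap_col (T : α ≃ μ.cells) {x y : α} (h : (T x).1.2 = (T y).1.2) (z : α) :
    (T (Equiv.swap x y z)).1.2 = (T z).1.2 := by
  rw [Equiv.swap_apply_def]; split_ifs with h1 h2 <;> simp_all

theorem rowSymmetrizer_mul_swap (T : α ≃ μ.cells) {x y : α} (h : (T x).1.1 = (T y).1.1) :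
    rowSymmetrizer T * single (Equiv.swap x y) 1 = rowSymmetrizer T :=
  rowSymmetrizer_mul_single T (swap_row T h)

theorem swap_mul_rowSymmetrizer (T : α ≃ μ.cells) {x y : α} (h : (T x).1.1 = (T y).1.1) :
    single (Equiv.swap x y) 1 * rowSymmetrizer T = rowSymmetrizer T :=
  single_mul_rowSymmetrizer_of_row T (swap_row T h)

theorem colAntisymmetrizer_mul_swap (T : α ≃ μ.cells) {x y : α} (hne : x ≠ y)
    (h : (T x).1.2 = (T y).1.2) :
    colAntisymmetrizer T * single (Equiv.swap x y) 1 = -colAntisymmetrizer T := by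
  rw [colAntisymmetrizer_mul_single T (swap_col T h), Equiv.Perm.sign_swap hne]; simp

theorem swap_mul_colAntisymmetrizer (T : α ≃ μ.cells) {x y : α} (hne : x ≠ y)
    (h : (T x).1.2 = (T y).1.2) :
    single (Equiv.swap x y) 1 * colAntisymmetrizer T = -colAntisymmetrizer T := by
  rw [single_mul_colAntisymmetrizer_of_col T (swap_col T h), Equiv.Perm.sign_swap hne]; simp

theorem eq_zero_of_eq_neg_self {A : Type*} [AddCommGroup A] [Module ℂ A] {a : A} (h : a = -a) :
    a = 0 := by
  have h2 : (2 : ℂ) • a = 0 := by rw [two_smul]; nth_rw 1 [h]; simp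
  exact (smul_eq_zero.1 h2).resolve_left two_ne_zero

theorem rowSymmetrizer_mul_colAntisymmetrizer_eq_zero (T : α ≃ lam.cells) (U : α ≃ μ.cells)
    {x y : α} (hne : x ≠ y) (hT : (T x).1.1 = (T y).1.1) (hU : (U x).1.2 = (U y).1.2) :
    rowSymmetrizer T * colAntisymmetrizer U = 0 := by
  apply eq_zero_of_eq_neg_self
  nth_rw 1 [← rowSymmetrizer_mul_swap T hT]
  rw [mul_assoc, swap_mul_colAntisymmetrizer U hne hU, mul_neg]

theorem colAntisymmetrizer_mul_rowSymmetrizer_eq_zero (T : α ≃ lam.cells) (U : α ≃ μ.cells)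
    {x y : α} (hne : x ≠ y) (hT : (T x).1.2 = (T y).1.2) (hU : (U x).1.1 = (U y).1.1) :
    colAntisymmetrizer T * rowSymmetrizer U = 0 := by
  apply eq_zero_of_eq_neg_self
  nth_rw 1 [← swap_mul_rowSymmetrizer U hU]
  rw [← mul_assoc, colAntisymmetrizer_mul_swap T hne hT, neg_mul]

theorem single_mul_one {G : Type*} [Group G] (g h : G) :
    (single (g * h) 1 : MonoidAlgebra ℂ G) = single g 1 * single h 1 := by
  rw [single_mul_single, one_mul]

theorem mul_mul_eq_zero_of_single {G : Type*} [Group G] {a b : MonoidAlgebra ℂ G}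
    (h : ∀ g, a * single g 1 * b = 0) (x : MonoidAlgebra ℂ G) : a * x * b = 0 := by
  induction x using MonoidAlgebra.induction_on with
  | of g => exact h g
  | add x y hx hy => rw [mul_add, add_mul, hx, hy, add_zero]
  | smul c x hx => rw [mul_smul_comm, smul_mul_assoc, hx, smul_zero]

/-- A transposition of two entries in a common row of one tableau and a common column of the other
is absorbed with sign `1` on one side and `-1` on the other. Such a pair survives when `g` relabels
the second tableau, because `exists_pair_of_ne` holds for all tableaux of the two shapes. -/
theorem youngSymmetrizer_mul_mul_eq_zero (h : lam ≠ μ) (T : α ≃ lam.cells) (U : α ≃ μ.cells)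
    (x : MonoidAlgebra ℂ (Equiv.Perm α)) :
    youngSymmetrizer T * x * youngSymmetrizer U = 0 := by
  unfold youngSymmetrizer
  rcases exists_pair_of_ne (α := α) h with h | h
  · have h0 := mul_mul_eq_zero_of_single (a := rowSymmetrizer T) (b := colAntisymmetrizer U)
      (fun g => by
        obtain ⟨x, y, hne, h1, h2⟩ := h T (permTableau g U)
        rw [mul_assoc, single_mul_colAntisymmetrizer, ← mul_assoc,
          rowSymmetrizer_mul_colAntisymmetrizer_eq_zero _ _ hne h1 h2, zero_mul])
      (colAntisymmetrizer T * x * rowSymmetrizer U)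
    simpa only [mul_assoc] using h0
  · have h0 := mul_mul_eq_zero_of_single (a := colAntisymmetrizer T) (b := rowSymmetrizer U)
      (fun g => by
        obtain ⟨x, y, hne, h1, h2⟩ := h T (permTableau g U)
        rw [mul_assoc, single_mul_rowSymmetrizer, ← mul_assoc,
          colAntisymmetrizer_mul_rowSymmetrizer_eq_zero _ _ hne h1 h2, zero_mul]) x
    calc _ = rowSymmetrizer T * (colAntisymmetrizer T * x * rowSymmetrizer U) *
          colAntisymmetrizer U := by simp only [mul_assoc]
      _ = 0 := by rw [h0, mul_zero, zero_mul]

/-- Von Neumann's lemma. -/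
theorem rowSymmetrizer_mul_mul_colAntisymmetrizer (T : α ≃ μ.cells)
    (x : MonoidAlgebra ℂ (Equiv.Perm α)) :
    ∃ c : ℂ, rowSymmetrizer T * x * colAntisymmetrizer T = c • youngSymmetrizer T := by
  induction x using MonoidAlgebra.induction_on with
  | add x y hx hy =>
    obtain ⟨c, hc⟩ := hx
    obtain ⟨d, hd⟩ := hy
    exact ⟨c + d, by rw [mul_add, add_mul, hc, hd, add_smul]⟩
  | smul r x hx =>
    obtain ⟨c, hc⟩ := hx
    exact ⟨r * c, by rw [mul_smul_comm, smul_mul_assoc, hc, mul_smul]⟩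
  | of g =>
    change ∃ c : ℂ, _ * single g 1 * _ = _
    by_cases hinj : Function.Injective fun x => ((T x).1.1, (permTableau g T x).1.2)
    · have him := (sum_fst_le_of_injective T (permTableau g T) hinj).2 le_rfl
      have hmem : ∀ x, ((T x).1.1, (permTableau g T x).1.2) ∈ μ.cells := fun x => by
        exact (Finset.ext_iff.1 him _).1 (mem_image_of_mem _ (mem_univ x))
      -- The positions (row in `T`, column in `g T`) fill the shape exactly, hence define a tableau
      -- `W`. It yields the factorization `g = r⁻¹ c` with `r` preserving the rows and `c` the
      -- columns of `T`.
      let V : α → μ.cells := fun x => ⟨((T x).1.1, (permTableau g T x).1.2), hmem x⟩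
      have hV : Function.Bijective V := by
        rw [Fintype.bijective_iff_injective_and_card]
        exact ⟨fun x y hxy => hinj (congrArg Subtype.val hxy), Fintype.card_congr T⟩
      let W : α ≃ μ.cells := Equiv.ofBijective V hV
      have hW1 : ∀ x, (W x).1.1 = (T x).1.1 := fun x => rfl
      have hW2 : ∀ x, (W x).1.2 = (T (g.symm x)).1.2 := fun x => rfl
      let r : Equiv.Perm α := W.trans T.symm
      have hr : ∀ x, (T (r x)).1.1 = (T x).1.1 := fun x => by simp [r, hW1]
      let c : Equiv.Perm α := r * g
      have hc : ∀ x, (T (c x)).1.2 = (T x).1.2 := fun x => by simp [c, r, hW2]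
      refine ⟨((Equiv.Perm.sign c : ℤ) : ℂ), ?_⟩
      calc rowSymmetrizer T * single g 1 * colAntisymmetrizer T
          = rowSymmetrizer T * single r 1 * single g 1 * colAntisymmetrizer T := by
            rw [rowSymmetrizer_mul_single T hr]
        _ = rowSymmetrizer T * (single c 1 * colAntisymmetrizer T) := by
            simp only [mul_assoc, c, single_mul_one]
        _ = _ := by
            rw [single_mul_colAntisymmetrizer_of_col T hc, mul_smul_comm, youngSymmetrizer]
    · refine ⟨0, ?_⟩
      simp only [Function.Injective, not_forall, Prod.mk.injEq] at hinj
      obtain ⟨x, y, ⟨h1, h2⟩, hne⟩ := hinj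
      rw [mul_assoc, single_mul_colAntisymmetrizer, ← mul_assoc,
        rowSymmetrizer_mul_colAntisymmetrizer_eq_zero _ _ hne h1 h2, zero_mul, zero_smul]

theorem youngSymmetrizer_mul_mul_self (T : α ≃ μ.cells) (x : MonoidAlgebra ℂ (Equiv.Perm α)) :
    ∃ c : ℂ, youngSymmetrizer T * x * youngSymmetrizer T = c • youngSymmetrizer T := by
  obtain ⟨c, hc⟩ := rowSymmetrizer_mul_mul_colAntisymmetrizer T
    (colAntisymmetrizer T * x * rowSymmetrizer T)
  exact ⟨c, by rw [← hc]; simp only [youngSymmetrizer, mul_assoc]⟩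

theorem coeff_youngSymmetrizer_one (T : α ≃ μ.cells) : (youngSymmetrizer T).coeff 1 = 1 := by
  -- The row group and the column group of `T` meet only in the identity.
  have key : ∀ σ τ : Equiv.Perm α, (∀ x, (T (σ x)).1.1 = (T x).1.1) →
      (∀ x, (T (τ x)).1.2 = (T x).1.2) → σ * τ = 1 → τ = 1 := by
    intro σ τ hσ hτ h
    ext x
    apply T.injective
    refine Subtype.ext (Prod.ext ?_ (hτ x))
    rw [← hσ (τ x), ← Equiv.Perm.mul_apply, h]
  simp only [youngSymmetrizer, rowSymmetrizer, colAntisymmetrizer, sum_mul, mul_sum,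
    single_mul_single, one_mul]
  simp only [coeff_sum, Finsupp.finsetSum_apply, coeff_single, Finsupp.single_apply]
  rw [sum_eq_single 1, sum_eq_single 1]
  · simp
  · intro τ hτ hne
    rw [if_neg]
    simpa using hne
  · simp
  · intro σ hσ hne
    refine sum_eq_zero fun τ hτ => if_neg fun h => hne ?_
    exact key τ σ (by simpa using hτ) (by simpa using hσ) h
  · simp

/-- A transposition between the row symmetrizer and the column antisymmetrizer contributes a
scalar that depends only on whether the two entries share a row or a column. -/
theorem rowSymmetrizer_mul_swap_mul_colAntisymmetrizer (T : α ≃ μ.cells) (x y : α) :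
    rowSymmetrizer T * single (Equiv.swap x y) 1 * colAntisymmetrizer T =
      ((if (T x).1.1 = (T y).1.1 then 1 else 0) - (if (T x).1.2 = (T y).1.2 then 1 else 0) +
        (if x = y then 1 else 0) : ℂ) • youngSymmetrizer T := by
  by_cases hxy : x = y
  · subst hxy
    rw [rowSymmetrizer_mul_swap T rfl]; simp [youngSymmetrizer]
  by_cases h1 : (T x).1.1 = (T y).1.1
  · have h2 : (T x).1.2 ≠ (T y).1.2 := fun h2 => hxy (T.injective (Subtype.ext (Prod.ext h1 h2)))
    rw [rowSymmetrizer_mul_swap T h1]; simp [youngSymmetrizer, h1, h2, hxy]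
  by_cases h2 : (T x).1.2 = (T y).1.2
  · rw [mul_assoc, swap_mul_colAntisymmetrizer T hxy h2]; simp [youngSymmetrizer, h1, h2, hxy]
  simp only [h1, h2, hxy, if_false, sub_zero, add_zero, zero_smul]
  wlog hlt : (T x).1.1 < (T y).1.1 generalizing x y
  · rw [Equiv.swap_comm]
    exact this y x (Ne.symm hxy) (Ne.symm h1) (Ne.symm h2) (by lia)
  -- The entry `z` in the row of `x` and the column of `y` exists because the row of `x` lies above
  -- that of `y`. In `(z x)(x y) = (x y)(z y)` the left factor `(z x)` is absorbed by the rows,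
  -- while the right factor `(z y)` costs a sign at the columns.
  have hz : ((T x).1.1, (T y).1.2) ∈ μ.cells :=
    μ.up_left_mem hlt.le le_rfl (show ((T y).1.1, (T y).1.2) ∈ μ from (T y).2)
  set z := T.symm ⟨_, hz⟩ with hzdef
  have hz1 : (T z).1.1 = (T x).1.1 := by simp [hzdef]
  have hz2 : (T z).1.2 = (T y).1.2 := by simp [hzdef]
  have hzx : z ≠ x := by rintro h; rw [h] at hz2; exact h2 hz2
  have hzy : z ≠ y := by rintro h; rw [h] at hz1; exact h1 hz1.symm
  apply eq_zero_of_eq_neg_self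
  have hcomm : Equiv.swap z x * Equiv.swap x y = Equiv.swap x y * Equiv.swap z y := by
    rw [Equiv.mul_swap_eq_swap_mul (Equiv.swap x y), Equiv.swap_apply_of_ne_of_ne hzx hzy,
      Equiv.swap_apply_right]
  calc rowSymmetrizer T * single (Equiv.swap x y) 1 * colAntisymmetrizer T
      = rowSymmetrizer T * single (Equiv.swap z x) 1 * single (Equiv.swap x y) 1 *
          colAntisymmetrizer T := by rw [rowSymmetrizer_mul_swap T hz1]
    _ = rowSymmetrizer T * single (Equiv.swap z x * Equiv.swap x y) 1 *
          colAntisymmetrizer T := by simp only [mul_assoc, single_mul_one]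
    _ = rowSymmetrizer T * single (Equiv.swap x y * Equiv.swap z y) 1 *
          colAntisymmetrizer T := by rw [hcomm]
    _ = rowSymmetrizer T * single (Equiv.swap x y) 1 * (single (Equiv.swap z y) 1 *
          colAntisymmetrizer T) := by
        simp only [mul_assoc, single_mul_one]
    _ = _ := by rw [swap_mul_colAntisymmetrizer T hzy hz2, mul_neg]

end

/-! ### Traces on the group algebra and characters of idempotents -/

section
variable {G H : Type*} [Group G] [Fintype G] [DecidableEq G] [Group H] [Fintype H] [DecidableEq H]

instance : Module.Finite ℂ (MonoidAlgebra ℂ G) := Module.Finite.of_basis (MonoidAlgebra.basis G ℂ)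

theorem coeff_single_mul_single (g h : G) (x : MonoidAlgebra ℂ G) (k : G) :
    (single g 1 * x * single h 1).coeff k = x.coeff (g⁻¹ * k * h⁻¹) := by
  induction x using MonoidAlgebra.induction_on with
  | of s =>
    have : g * s * h = k ↔ s = g⁻¹ * k * h⁻¹ := by
      constructor
      · rintro rfl; group
      · rintro rfl; group
    simp [single_mul_single, Finsupp.single_apply, this]
  | add x y hx hy => simp [mul_add, add_mul, hx, hy]
  | smul c x hx => simp [hx]

theorem trace_mulLeftRight (a b : MonoidAlgebra ℂ G) :
    LinearMap.trace ℂ _ (LinearMap.mulLeftRight ℂ (a, b)) =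
      ∑ h : G, (a * single h 1 * b).coeff h := by
  rw [LinearMap.trace_eq_matrix_trace ℂ (MonoidAlgebra.basis G ℂ), Matrix.trace]
  refine sum_congr rfl fun h _ => ?_
  simp [LinearMap.toMatrix_apply, MonoidAlgebra.basis]

/-- The character of the left ideal generated by an idempotent `e`. -/
def idemChar (e : MonoidAlgebra ℂ G) (g : G) : ℂ :=
  LinearMap.trace ℂ _ (LinearMap.mulLeftRight ℂ ((single g 1 : MonoidAlgebra ℂ G), e))

theorem idemChar_eq_sum (e : MonoidAlgebra ℂ G) (g : G) :
    idemChar e g = ∑ h : G, e.coeff (h⁻¹ * g⁻¹ * h) := by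
  rw [idemChar, trace_mulLeftRight]
  refine sum_congr rfl fun h _ => ?_
  have := coeff_single_mul_single (g * h) 1 e h
  rw [← MonoidAlgebra.one_def, mul_one, single_mul_one] at this
  rw [this]; congr 1; group

theorem sum_coeff_mul_idemChar (φ : H →* G) (a : MonoidAlgebra ℂ H) (e : MonoidAlgebra ℂ G) :
    ∑ s, a.coeff s * idemChar e (φ s) = LinearMap.trace ℂ _
      (LinearMap.mulLeftRight ℂ (mapDomainAlgHom ℂ ℂ φ a, e)) := by
  induction a using MonoidAlgebra.induction_on with
  | of s => simp [idemChar, Finsupp.single_apply]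
  | add x y hx hy =>
    rw [trace_mulLeftRight] at *
    simp [add_mul, sum_add_distrib, hx, hy, mapDomain_add]
  | smul c x hx =>
    rw [trace_mulLeftRight] at *
    simp [mul_assoc, ← mul_sum, hx]

/-- `idemChar a s⁻¹` sums the coefficients of `a` over all conjugates of `s`, and `f` does not
distinguish these. -/
theorem sum_idemChar_mul (a : MonoidAlgebra ℂ H) (f : H → ℂ) (hf : ∀ g h, f (h * g * h⁻¹) = f g) :
    ∑ s, idemChar a s⁻¹ * f s = Fintype.card H * ∑ s, a.coeff s * f s := by
  simp only [idemChar_eq_sum, sum_mul, inv_inv]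
  rw [sum_comm, ← nsmul_eq_mul, ← card_univ, ← sum_const]
  refine sum_congr rfl fun h _ => ?_
  rw [← (MulAut.conj h).toEquiv.sum_comp]
  refine sum_congr rfl fun s _ => ?_
  change a.coeff (h⁻¹ * (h * s * h⁻¹) * h) * f (h * s * h⁻¹) = _
  rw [hf]; congr 2; group

theorem idemChar_conj (e : MonoidAlgebra ℂ G) (g h : G) :
    idemChar e (h * g * h⁻¹) = idemChar e g := by
  rw [idemChar_eq_sum, idemChar_eq_sum, ← Equiv.sum_comp (Equiv.mulLeft h)]
  refine sum_congr rfl fun k _ => ?_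
  simp [mul_assoc]

/-- For idempotents, `x ↦ φ(a) x e` is a projection, so its trace is its rank. The identity as `φ`
gives the orthogonality relations; the embedding of a point stabilizer gives the restriction
multiplicities. -/
theorem sum_idemChar_mul_idemChar (φ : H →* G) {a : MonoidAlgebra ℂ H} {e : MonoidAlgebra ℂ G}
    (ha : IsIdempotentElem a) (he : IsIdempotentElem e) :
    ∑ s, idemChar a s⁻¹ * idemChar e (φ s) = Fintype.card H *
      (Module.finrank ℂ (LinearMap.mulLeftRight ℂ (mapDomainAlgHom ℂ ℂ φ a, e)).range : ℂ) := by
  rw [sum_idemChar_mul, sum_coeff_mul_idemChar]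
  · congr 1
    apply LinearMap.IsProj.trace
    rw [LinearMap.isProj_range_iff_isIdempotentElem]
    have ha' : mapDomainAlgHom ℂ ℂ φ a * mapDomainAlgHom ℂ ℂ φ a = mapDomainAlgHom ℂ ℂ φ a := by
      rw [← map_mul, ha]
    refine LinearMap.ext fun x => ?_
    simp only [Module.End.mul_apply, LinearMap.mulLeftRight_apply]
    simp only [← mul_assoc, ha']
    simp only [mul_assoc, he.eq]
  · intro g h
    rw [map_mul, map_mul, map_inv, idemChar_conj]

end

/-! ### The idempotent of a tableau -/

section
variable {α : Type*} [Fintype α] [DecidableEq α] {lam μ : YoungDiagram}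

/-- If the square were zero, right multiplication by the symmetrizer would be nilpotent, hence of
trace `0`. Its trace is the group order, since the coefficient at the identity is `1`. -/
theorem exists_youngSymmetrizer_mul_self (T : α ≃ μ.cells) :
    ∃ k : ℂ, k ≠ 0 ∧ youngSymmetrizer T * youngSymmetrizer T = k • youngSymmetrizer T := by
  obtain ⟨k, hk⟩ := youngSymmetrizer_mul_mul_self T 1
  rw [mul_one] at hk
  refine ⟨k, ?_, hk⟩
  rintro rfl
  rw [zero_smul] at hk
  have hnil : IsNilpotent (LinearMap.mulLeftRight ℂ
      ((1 : MonoidAlgebra ℂ (Equiv.Perm α)), youngSymmetrizer T)) := by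
    refine ⟨2, ?_⟩
    refine LinearMap.ext fun x => ?_
    simp [pow_two, Module.End.mul_apply, mul_assoc, hk]
  have h0 := (LinearMap.isNilpotent_trace_of_isNilpotent hnil).eq_zero
  rw [trace_mulLeftRight] at h0
  have h1 : ∀ h : Equiv.Perm α,
      ((1 : MonoidAlgebra ℂ (Equiv.Perm α)) * single h 1 * youngSymmetrizer T).coeff h = 1 := by
    intro h
    have := coeff_single_mul_single h 1 (youngSymmetrizer T) h
    rw [← MonoidAlgebra.one_def, mul_one] at this
    rw [one_mul, this]
    simp [coeff_youngSymmetrizer_one]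
  rw [sum_congr rfl fun h _ => h1 h] at h0
  simp [Fintype.card_perm, Nat.factorial_ne_zero] at h0

/-- The scalar `k` with `e * e = k • e` for the Young symmetrizer `e`. -/
def symmetrizerScalar (T : α ≃ μ.cells) : ℂ := (exists_youngSymmetrizer_mul_self T).choose

theorem symmetrizerScalar_ne_zero (T : α ≃ μ.cells) : symmetrizerScalar T ≠ 0 :=
  (exists_youngSymmetrizer_mul_self T).choose_spec.1

theorem youngSymmetrizer_mul_self (T : α ≃ μ.cells) :
    youngSymmetrizer T * youngSymmetrizer T = symmetrizerScalar T • youngSymmetrizer T :=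
  (exists_youngSymmetrizer_mul_self T).choose_spec.2

theorem youngSymmetrizer_ne_zero (T : α ≃ μ.cells) : youngSymmetrizer T ≠ 0 := by
  intro h
  have := coeff_youngSymmetrizer_one T
  simp [h] at this

/-- The idempotent proportional to the Young symmetrizer. -/
def youngIdempotent (T : α ≃ μ.cells) : MonoidAlgebra ℂ (Equiv.Perm α) :=
  (symmetrizerScalar T)⁻¹ • youngSymmetrizer T

theorem isIdempotentElem_youngIdempotent (T : α ≃ μ.cells) :
    IsIdempotentElem (youngIdempotent T) := by
  have := symmetrizerScalar_ne_zero T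
  rw [IsIdempotentElem, youngIdempotent, smul_mul_smul_comm, youngSymmetrizer_mul_self, smul_smul]
  congr 1; field_simp

theorem youngSymmetrizer_mul_youngIdempotent (T : α ≃ μ.cells) :
    youngSymmetrizer T * youngIdempotent T = youngSymmetrizer T := by
  rw [youngIdempotent, mul_smul_comm, youngSymmetrizer_mul_self, smul_smul,
    inv_mul_cancel₀ (symmetrizerScalar_ne_zero T), one_smul]

/-- The map `x ↦ g x e` has its image in the Specht ideal, so its trace can be taken there, where
right multiplication by the idempotent `e` is the identity. -/
theorem character_spechtRep (T : α ≃ μ.cells) (g : Equiv.Perm α) :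
    (spechtRep T).character g = idemChar (youngIdempotent T) g := by
  have hmem : ∀ x, LinearMap.mulLeftRight ℂ (single g 1, youngIdempotent T) x ∈
      (spechtModule T).restrictScalars ℂ := fun x => by
    rw [LinearMap.mulLeftRight_apply, youngIdempotent, mul_smul_comm]
    refine Submodule.smul_mem _ _ ?_
    exact Ideal.mul_mem_left _ _ (Ideal.subset_span rfl)
  rw [idemChar, ← LinearMap.trace_restrict_eq_of_forall_mem _ _ hmem fun x _ => hmem x,
    Representation.character]
  congr 1
  ext1 ⟨x, hx⟩
  refine Subtype.ext ?_
  obtain ⟨y, rfl⟩ := Ideal.mem_span_singleton'.1 hx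
  change single g 1 * (y * youngSymmetrizer T) =
    single g 1 * (y * youngSymmetrizer T) * youngIdempotent T
  simp only [mul_assoc, youngSymmetrizer_mul_youngIdempotent]

end

/-! ### Cycle types and adding a fixed point -/

section
variable {α β : Type*} [Fintype α] [DecidableEq α] [Fintype β] [DecidableEq β]

theorem parts_eq (σ : Equiv.Perm α) : σ.partition.parts =
    σ.cycleType + Multiset.replicate (Fintype.card α - σ.cycleType.sum) 1 := by
  rw [parts_partition, sum_cycleType]

theorem parts_eq_of_cycleType_eq {σ : Equiv.Perm α} {τ : Equiv.Perm β}
    (hc : Fintype.card α = Fintype.card β) (h : σ.cycleType = τ.cycleType) :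
    σ.partition.parts = τ.partition.parts := by
  rw [parts_eq, parts_eq, h, hc]

theorem parts_inv (σ : Equiv.Perm α) : (σ⁻¹).partition.parts = σ.partition.parts :=
  parts_eq_of_cycleType_eq rfl (cycleType_inv σ)

theorem parts_conj (σ τ : Equiv.Perm α) :
    (τ * σ * τ⁻¹).partition.parts = σ.partition.parts :=
  parts_eq_of_cycleType_eq rfl cycleType_conj

theorem parts_permCongr (e : α ≃ β) (σ : Equiv.Perm α) :
    (e.permCongr σ).partition.parts = σ.partition.parts := by
  have h : e.permCongr σ =
      σ.extendDomain (e.trans (Equiv.Set.univ β).symm : α ≃ {x // x ∈ Set.univ}) := by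
    ext x
    rw [extendDomain_apply_subtype _ _ (Set.mem_univ x)]
    simp
  refine parts_eq_of_cycleType_eq (Fintype.card_congr e).symm ?_
  rw [h, cycleType_extendDomain]

/-- The embedding of the permutations of `α` into those of `Option α`. -/
def optionPerm : Equiv.Perm α →* Equiv.Perm (Option α) where
  toFun σ := Equiv.optionCongr σ
  map_one' := Equiv.optionCongr_one
  map_mul' σ τ := Equiv.ext fun x => by cases x <;> rfl

@[simp] theorem optionPerm_none (σ : Equiv.Perm α) : optionPerm σ none = none := rfl

@[simp] theorem optionPerm_some (σ : Equiv.Perm α) (a : α) :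
    optionPerm σ (some a) = some (σ a) := rfl

theorem parts_optionPerm (σ : Equiv.Perm α) :
    (optionPerm σ).partition.parts = 1 ::ₘ σ.partition.parts := by
  have h : optionPerm σ = σ.extendDomain (Equiv.optionIsSomeEquiv α).symm := by
    refine Equiv.ext fun x => ?_
    cases x with
    | none => rw [extendDomain_apply_not_subtype _ _ (by simp)]; simp
    | some a => rw [extendDomain_apply_subtype _ _ (by simp)]; simp [Equiv.optionIsSomeEquiv]
  have h' : (optionPerm σ).cycleType = σ.cycleType := by rw [h, cycleType_extendDomain]
  rw [parts_eq, parts_eq, h', Fintype.card_option, Nat.succ_sub, Multiset.replicate_succ,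
    Multiset.add_cons]
  exact sum_cycleType_le σ

/-- The length of the cycle of `σ` through `a`. -/
def cycleLen (σ : Equiv.Perm α) (a : α) : ℕ := if σ a = a then 1 else #(cycleOf σ a).support

/-- The points are grouped by cycles, and a cycle of length `k` has `k` points. Fixed points are
treated apart since `cycleType` omits them. -/
theorem sum_cycleLen {M : Type*} [AddCommMonoid M] (σ : Equiv.Perm α) (f : ℕ → M) :
    ∑ a, f (cycleLen σ a) = (σ.partition.parts.map fun k => k • f k).sum := by
  rw [parts_partition, Multiset.map_add, Multiset.sum_add, Multiset.map_replicate,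
    Multiset.sum_replicate, cycleType_def, Multiset.map_map,
    ← sum_add_sum_compl σ.support, ← card_compl, one_smul, ← sum_const]
  congr 1
  · rw [← sum_fiberwise_of_maps_to (t := σ.cycleFactorsFinset) (g := fun a => cycleOf σ a)
      fun a ha => cycleOf_mem_cycleFactorsFinset_iff.2 ha]
    refine sum_congr rfl fun c hc => ?_
    have : {a ∈ σ.support | cycleOf σ a = c} = c.support := by
      ext a
      rw [mem_filter]
      constructor
      · rintro ⟨ha, rfl⟩
        rw [mem_support_cycleOf_iff]
        exact ⟨SameCycle.refl _ _, ha⟩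
      · intro ha
        exact ⟨mem_cycleFactorsFinset_support_le hc ha, (cycle_is_cycleOf ha hc).symm⟩
    rw [Function.comp_apply, Function.comp_apply, ← sum_const]
    rw [← this]
    refine sum_congr rfl fun a ha => ?_
    have ha' := mem_filter.1 ha
    rw [cycleLen, if_neg (mem_support.1 ha'.1), ha'.2, this]
  · refine sum_congr rfl fun a ha => ?_
    rw [mem_compl, mem_support, not_not] at ha
    rw [cycleLen, if_pos ha]

/-- The transposition inserts the fixed point `z` into the cycle of `b`: the part `1` of `z`
disappears and the cycle of `b` grows by one. -/
theorem parts_swap_mul {τ : Equiv.Perm α} {z b : α} (hz : τ z = z) (hb : b ≠ z) :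
    (Equiv.swap z b * τ).partition.parts =
      (cycleLen τ b + 1) ::ₘ (τ.partition.parts.erase 1).erase (cycleLen τ b) := by
  have hfix : ∀ s : Finset α, Disjoint s τ.support → #s + τ.cycleType.sum ≤ Fintype.card α := by
    intro s hs
    rw [sum_cycleType, ← card_union_of_disjoint hs]
    exact card_le_univ _
  by_cases h : τ b = b
  · have hd : (Equiv.swap z b).Disjoint τ := by
      intro x
      by_cases hx : x = z ∨ x = b
      · right; rcases hx with rfl | rfl <;> assumption
      · left; push Not at hx; exact Equiv.swap_apply_of_ne_of_ne hx.1 hx.2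
    have hct : (Equiv.swap z b * τ).cycleType = 2 ::ₘ τ.cycleType := by
      rw [hd.cycleType_mul, (isCycle_swap hb.symm).cycleType, card_support_swap hb.symm,
        Multiset.singleton_add]
    have h2 := hfix {z, b} (by simp [Finset.disjoint_left, hz, h])
    rw [card_pair hb.symm] at h2
    obtain ⟨m, hm⟩ := Nat.exists_eq_add_of_le h2
    rw [parts_eq, parts_eq, hct, cycleLen, if_pos h, Multiset.sum_cons, hm, Nat.add_sub_cancel_left,
      show 2 + τ.cycleType.sum + m - τ.cycleType.sum = m + 1 + 1 by lia, Multiset.replicate_succ,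
      Multiset.replicate_succ, Multiset.add_cons, Multiset.erase_cons_head, Multiset.add_cons,
      Multiset.erase_cons_head, Multiset.cons_add]
  · have hb' : b ∈ τ.support := mem_support.2 h
    have hc := cycleOf_mem_cycleFactorsFinset_iff.2 hb'
    set c := cycleOf τ b with hcdef
    have hcy : c.IsCycle := isCycle_cycleOf τ h
    have hd : (τ * c⁻¹).Disjoint c := disjoint_mul_inv_of_mem_cycleFactorsFinset hc
    have hτ : c * (τ * c⁻¹) = τ := by rw [← hd.commute.eq]; group
    have hctτ : τ.cycleType = #c.support ::ₘ (τ * c⁻¹).cycleType := by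
      conv_lhs => rw [← hτ, hd.symm.cycleType_mul, hcy.cycleType, Multiset.singleton_add]
    have hlen := (toList_eq_nil_iff (p := τ) (x := b)).not.2 (not_not.2 hb')
    have hl2 := two_le_length_toList_iff_mem_support.2 hb'
    have hzl : z ∉ toList τ b := fun hm => by
      have := (mem_toList_iff.1 hm)
      have h3 := (this.1.mem_support_iff).1 hb'
      exact mem_support.1 h3 hz
    -- Written as a list, the cycle through `b` is simply prolonged by `z` at its head; the rest `τ
    -- * c⁻¹` of the permutation is not touched.
    have hsw : Equiv.swap z b * c = List.formPerm (z :: toList τ b) := by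
      rw [hcdef, ← formPerm_toList]
      have h0 := toList_getElem_zero τ b hb'
      obtain ⟨y, l, hyl⟩ := List.exists_cons_of_ne_nil hlen
      simp only [hyl, List.getElem_cons_zero] at h0 ⊢
      rw [← h0, List.formPerm_cons_cons]
    have hnd : (z :: toList τ b).Nodup := List.nodup_cons.2 ⟨hzl, nodup_toList τ b⟩
    have hct1 : (Equiv.swap z b * c).cycleType = {#c.support + 1} := by
      rw [hsw, (List.isCycle_formPerm hnd (by rw [List.length_cons]; lia)).cycleType,
        List.support_formPerm_of_nodup _ hnd fun x hx => hlen (List.cons.inj hx).2,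
        List.toFinset_card_of_nodup hnd, List.length_cons, Equiv.Perm.length_toList]
    have hd' : (Equiv.swap z b * c).Disjoint (τ * c⁻¹) := by
      intro x
      by_cases hx : x ∈ z :: toList τ b
      · right
        rcases List.mem_cons.1 hx with rfl | hx
        · have : c⁻¹ x = x := by
            rw [inv_eq_iff_eq]
            rw [hcdef]
            refine (cycleOf_apply_of_not_sameCycle fun hs => ?_).symm
            exact mem_support.1 ((hs.mem_support_iff).1 hb') hz
          rw [Equiv.Perm.mul_apply, this, hz]
        · rcases hd x with h | h
          · exact h
          · rw [mem_toList_iff] at hx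
            rw [hcdef, hx.1.cycleOf_apply] at h
            exact absurd h (mem_support.1 ((hx.1.mem_support_iff).1 hb'))
      · left
        rw [hsw, List.formPerm_apply_of_notMem hx]
    have hct : (Equiv.swap z b * τ).cycleType =
        (#c.support + 1) ::ₘ (τ * c⁻¹).cycleType := by
      conv_lhs => rw [← hτ, ← mul_assoc, hd'.cycleType_mul, hct1, Multiset.singleton_add]
    have h2 := hfix {z} (by simp [hz])
    rw [card_singleton] at h2
    obtain ⟨m, hm⟩ := Nat.exists_eq_add_of_le h2
    rw [parts_eq, parts_eq τ, hct, cycleLen, if_neg h, ← hcdef, hm,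
      show 1 + τ.cycleType.sum + m - τ.cycleType.sum = m + 1 by lia, Multiset.replicate_succ,
      Multiset.add_cons, Multiset.erase_cons_head, hctτ, Multiset.sum_cons, Multiset.sum_cons,
      Multiset.cons_add, Multiset.cons_add, Multiset.erase_cons_head]
    congr 3
    lia

theorem count_one_parts (σ : Equiv.Perm α) : σ.partition.parts.count 1 = #{x | σ x = x} := by
  rw [parts_partition, Multiset.count_add, Multiset.count_replicate_self,
    Multiset.count_eq_zero_of_notMem fun h => absurd (one_lt_of_mem_cycleType h) (lt_irrefl 1),
    zero_add, ← card_compl]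
  congr 1
  ext x; simp

theorem sum_perm_option {M : Type*} [AddCommMonoid M] (f : Equiv.Perm (Option α) → M) :
    ∑ g, f g = ∑ a : Option α, ∑ s : Equiv.Perm α, f (Equiv.swap none a * optionPerm s) := by
  rw [← Equiv.Perm.decomposeOption.symm.sum_comp, Fintype.sum_prod_type]
  rfl

/-- Pairs of a permutation and one of its fixed points are counted in two ways. Conjugation by a
transposition moves the fixed point to `none`. -/
theorem sum_count_one_mul (f : Multiset ℕ → ℂ) :
    ∑ g : Equiv.Perm (Option α), (g.partition.parts.count 1 : ℂ) * f g.partition.parts =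
      (Fintype.card α + 1) * ∑ s : Equiv.Perm α, f (1 ::ₘ s.partition.parts) := by
  have h1 : ∀ g : Equiv.Perm (Option α), (g.partition.parts.count 1 : ℂ) * f g.partition.parts =
      ∑ x : Option α, if g x = x then f g.partition.parts else 0 := by
    intro g
    rw [count_one_parts, ← sum_filter, sum_const, nsmul_eq_mul]
  have h2 : ∀ x : Option α,
      ∑ g : Equiv.Perm (Option α), (if g x = x then f g.partition.parts else 0) =
        ∑ s : Equiv.Perm α, f (1 ::ₘ s.partition.parts) := by
    intro x
    rw [← Equiv.sum_comp (MulAut.conj (Equiv.swap none x)).toEquiv]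
    have h3 : ∀ g : Equiv.Perm (Option α),
        (if (MulAut.conj (Equiv.swap none x)).toEquiv g x = x then
          f ((MulAut.conj (Equiv.swap none x)).toEquiv g).partition.parts else 0) =
        if g none = none then f g.partition.parts else 0 := by
      intro g
      change (if (Equiv.swap none x * g * (Equiv.swap none x)⁻¹) x = x then
        f (Equiv.swap none x * g * (Equiv.swap none x)⁻¹).partition.parts else 0) = _
      rw [parts_conj]
      congr 1
      simp [Equiv.swap_apply_eq_iff]
    simp only [h3]
    rw [sum_perm_option, Fintype.sum_option]
    simp only [Equiv.swap_self]
    rw [sum_eq_zero (s := (univ : Finset α)) fun a _ => sum_eq_zero fun s _ => by simp, add_zero]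
    refine sum_congr rfl fun s _ => ?_
    rw [← parts_optionPerm]
    exact if_pos rfl
  simp only [h1]
  rw [sum_comm]
  simp only [h2]
  simp

end

/-! ### Independence of the tableau -/

section
variable {α β : Type*} [Fintype α] [DecidableEq α] [Fintype β] [DecidableEq β] {μ : YoungDiagram}

theorem domCongr_youngSymmetrizer (e : α ≃ β) (U : β ≃ μ.cells) :
    domCongr ℂ ℂ e.permCongrHom (youngSymmetrizer (e.trans U)) = youngSymmetrizer U := by
  rw [youngSymmetrizer, map_mul, youngSymmetrizer, rowSymmetrizer, rowSymmetrizer,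
    colAntisymmetrizer, colAntisymmetrizer, map_sum, map_sum]
  have hmem : ∀ (f : ℕ × ℕ → ℕ) (σ : Equiv.Perm α),
      (∀ x, f ((e.trans U) (σ x)).1 = f ((e.trans U) x).1) ↔
        ∀ x, f (U (e.permCongr σ x)).1 = f (U x).1 := by
    intro f σ
    rw [e.forall_congr_left]
    simp
  congr 1
  · refine sum_equiv e.permCongr ?_ ?_
    · intro σ
      rw [mem_filter_univ, mem_filter_univ]
      exact hmem Prod.fst σ
    · intro σ _; simp
  · refine sum_equiv e.permCongr ?_ ?_
    · intro σ
      rw [mem_filter_univ, mem_filter_univ]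
      exact hmem Prod.snd σ
    · intro σ _; simp

theorem idemChar_domCongr {G H : Type*} [Group G] [Fintype G] [DecidableEq G] [Group H] [Fintype H]
    [DecidableEq H] (e : G ≃* H) (a : MonoidAlgebra ℂ G) (g : G) :
    idemChar (domCongr ℂ ℂ e a) (e g) = idemChar a g := by
  rw [idemChar_eq_sum, idemChar_eq_sum, ← Equiv.sum_comp e.toEquiv]
  refine sum_congr rfl fun h _ => ?_
  rw [coeff_domCongr]
  simp

theorem domCongr_youngIdempotent (e : α ≃ β) (U : β ≃ μ.cells) :
    domCongr ℂ ℂ e.permCongrHom (youngIdempotent (e.trans U)) = youngIdempotent U := by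
  have hs : symmetrizerScalar (e.trans U) = symmetrizerScalar U := by
    have h := congrArg (domCongr ℂ ℂ e.permCongrHom) (youngSymmetrizer_mul_self (e.trans U))
    rw [map_mul, map_smul, domCongr_youngSymmetrizer, youngSymmetrizer_mul_self] at h
    exact (smul_left_injective ℂ (youngSymmetrizer_ne_zero U) h).symm
  rw [youngIdempotent, map_smul, domCongr_youngSymmetrizer, youngIdempotent, hs]

/-- This frees the character from the set `Fin μ.card`: tableaux with entries in `Option (Fin n)`
can be used for the restriction to a point stabilizer. -/
theorem charAt_eq_idemChar (T : α ≃ μ.cells) (σ : Equiv.Perm α) :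
    charAt μ σ.partition.parts = idemChar (youngIdempotent T) σ := by
  set U : Fin μ.card ≃ μ.cells := μ.cells.equivFin.symm
  set e : α ≃ Fin μ.card := T.trans U.symm
  have hT : T = e.trans U := by ext1 x; simp [e]
  rw [← parts_permCongr e, charAt_parts, irrChar, character_spechtRep, hT,
    ← idemChar_domCongr e.permCongrHom, domCongr_youngIdempotent]
  rfl

end

/-! ### Corners -/

section
variable {μ ν : YoungDiagram}

theorem corner_mem (c : corners μ) : c.1 ∈ μ.cells := (mem_corners.1 c.2).1

theorem card_eraseCorner (c : corners μ) : (eraseCorner μ c).card + 1 = μ.card :=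
  card_erase_add_one (corner_mem c)

theorem rowLen_corner (c : corners μ) : μ.rowLen c.1.1 = c.1.2 + 1 := by
  obtain ⟨⟨i, j⟩, hc⟩ := c
  obtain ⟨h1, h2⟩ := mem_corners.1 hc
  have h3 := YoungDiagram.mem_iff_lt_rowLen.1 h1
  have h4 : (i, j + 1) ∉ μ := fun h => by
    have : (i, j) ∈ (↑(μ.cells.erase (i, j)) : Set (ℕ × ℕ)) :=
      h2 (Prod.mk_le_mk.2 ⟨le_rfl, Nat.le_succ j⟩) (mem_coe.2 (mem_erase.2 ⟨by simp, h⟩))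
    simp at this
  rw [YoungDiagram.mem_iff_lt_rowLen] at h4
  simp only
  lia

theorem colLen_corner (c : corners μ) : μ.colLen c.1.2 = c.1.1 + 1 := by
  obtain ⟨⟨i, j⟩, hc⟩ := c
  obtain ⟨h1, h2⟩ := mem_corners.1 hc
  have h3 := YoungDiagram.mem_iff_lt_colLen.1 h1
  have h4 : (i + 1, j) ∉ μ := fun h => by
    have : (i, j) ∈ (↑(μ.cells.erase (i, j)) : Set (ℕ × ℕ)) :=
      h2 (Prod.mk_le_mk.2 ⟨Nat.le_succ i, le_rfl⟩) (mem_coe.2 (mem_erase.2 ⟨by simp, h⟩))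
    simp at this
  rw [YoungDiagram.mem_iff_lt_colLen] at h4
  simp only
  lia

theorem eraseCorner_injective (μ : YoungDiagram) : Function.Injective (eraseCorner μ) := by
  intro c d h
  have h1 : μ.cells.erase c.1 = μ.cells.erase d.1 := congrArg YoungDiagram.cells h
  by_contra hne
  have : c.1 ∈ μ.cells.erase d.1 := mem_erase.2 ⟨fun h => hne (Subtype.ext h), corner_mem c⟩
  rw [← h1] at this
  simp at this

theorem exists_eraseCorner_eq (ν : YoungDiagram) (i : ℕ)
    (h : ∀ k, k < i → ν.rowLen i < ν.rowLen k) :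
    ∃ (μ : YoungDiagram) (c : corners μ), eraseCorner μ c = ν ∧ c.1.1 = i := by
  have hn : (i, ν.rowLen i) ∉ ν.cells := fun h => by
    have := YoungDiagram.mem_iff_lt_rowLen.1 h
    exact lt_irrefl _ this
  have hl : IsLowerSet (↑(insert (i, ν.rowLen i) ν.cells) : Set (ℕ × ℕ)) := by
    rintro ⟨a, b⟩ ⟨a', b'⟩ hle hab
    obtain ⟨h1, h2⟩ := Prod.mk_le_mk.1 hle
    simp only [coe_insert, Set.mem_insert_iff, mem_coe, Prod.mk.injEq, YoungDiagram.mem_cells] at hab ⊢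
    rcases hab with ⟨rfl, rfl⟩ | hab
    · rcases h1.lt_or_eq with h1 | rfl
      · right
        rw [YoungDiagram.mem_iff_lt_rowLen]
        exact h2.trans_lt (h _ h1)
      · rcases h2.lt_or_eq with h2 | rfl
        · right; rwa [YoungDiagram.mem_iff_lt_rowLen]
        · left; exact ⟨rfl, rfl⟩
    · right; exact ν.up_left_mem h1 h2 hab
  let μ : YoungDiagram := ⟨insert (i, ν.rowLen i) ν.cells, hl⟩
  have he : μ.cells.erase (i, ν.rowLen i) = ν.cells := erase_insert hn
  have hc : (i, ν.rowLen i) ∈ corners μ :=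
    mem_corners.2 ⟨mem_insert_self _ _, by rw [he]; exact ν.isLowerSet⟩
  exact ⟨μ, ⟨_, hc⟩, YoungDiagram.ext he, rfl⟩

/-- There is one more way to add a cell than to erase one. -/
theorem exists_add_cell (ν : YoungDiagram) :
    ∃ f : Option (corners ν) → YoungDiagram, Function.Injective f ∧
      ∀ o, ∃ c, eraseCorner (f o) c = ν := by
  -- A cell can be added in the top row and in the row just below each corner. These rows are
  -- distinct because a row has at most one corner.
  let r : Option (corners ν) → ℕ := fun o => o.elim 0 fun c => c.1.1 + 1
  have hr : Function.Injective r := by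
    rintro (_ | c) (_ | d) h
    · rfl
    · simp [r] at h
    · simp [r] at h
    · have h1 : c.1.1 = d.1.1 := by simpa [r] using h
      have h2 := rowLen_corner c
      rw [h1, rowLen_corner d] at h2
      exact congrArg some (Subtype.ext (Prod.ext h1 (by lia)))
  have hex : ∀ o, ∃ (μ : YoungDiagram) (c : corners μ), eraseCorner μ c = ν ∧ c.1.1 = r o := by
    intro o
    refine exists_eraseCorner_eq ν (r o) ?_
    rcases o with _ | c
    · intro k hk; exact absurd hk (Nat.not_lt_zero k)
    · intro k hk
      have hk' : k ≤ c.1.1 := Nat.lt_succ_iff.1 hk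
      refine lt_of_lt_of_le ?_ (ν.rowLen_anti _ _ hk')
      have h1 := colLen_corner c
      have h2 : (c.1.1 + 1, c.1.2) ∉ ν := by rw [YoungDiagram.mem_iff_lt_colLen, h1]; lia
      rw [YoungDiagram.mem_iff_lt_rowLen] at h2
      rw [rowLen_corner]
      change ν.rowLen (c.1.1 + 1) < _
      lia
  choose f c hc hcr using hex
  refine ⟨f, fun o o' h => hr ?_, fun o => ⟨c o, hc o⟩⟩
  rw [← hcr, ← hcr]
  have : ∀ (μ₁ μ₂ : YoungDiagram) (c₁ : corners μ₁) (c₂ : corners μ₂), μ₁ = μ₂ →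
      eraseCorner μ₁ c₁ = ν → eraseCorner μ₂ c₂ = ν → c₁.1.1 = c₂.1.1 := by
    rintro μ₁ _ c₁ c₂ rfl h1 h2
    rw [eraseCorner_injective _ (h1.trans h2.symm)]
  exact this _ _ _ _ h (hc o) (hc o')

end

/-! ### Diagrams and partitions -/

theorem sum_rowLens (μ : YoungDiagram) : μ.rowLens.sum = μ.card := by
  rw [YoungDiagram.card, card_eq_sum_card_fiberwise (f := Prod.fst) (t := range (μ.colLen 0))]
  · rw [YoungDiagram.rowLens, ← List.sum_toFinset _ List.nodup_range, List.toFinset_range]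
    exact sum_congr rfl fun i _ => μ.rowLen_eq_card
  · rintro ⟨i, j⟩ h
    rw [mem_coe, mem_range, ← YoungDiagram.mem_iff_lt_colLen]
    exact μ.up_left_mem le_rfl (Nat.zero_le j) h

/-- The partition whose parts are the row lengths of a Young diagram. -/
def rowPartition {n : ℕ} (μ : {μ : YoungDiagram // μ.card = n}) : n.Partition where
  parts := μ.1.rowLens
  parts_pos {i} hi := μ.1.pos_of_mem_rowLens i hi
  parts_sum := by rw [Multiset.sum_coe, sum_rowLens, μ.2]

theorem rowPartition_bijective (n : ℕ) : Function.Bijective (rowPartition (n := n)) := by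
  constructor
  · intro μ ν h
    have h1 : (μ.1.rowLens : Multiset ℕ) = ν.1.rowLens := congrArg Nat.Partition.parts h
    have h2 : μ.1.rowLens = ν.1.rowLens := (Multiset.coe_eq_coe.1 h1).eq_of_pairwise'
      μ.1.rowLens_sorted.pairwise ν.1.rowLens_sorted.pairwise
    exact Subtype.ext (YoungDiagram.equivListRowLens.injective (Subtype.ext h2))
  · intro l
    have hw : (l.parts.sort (· ≥ ·)).SortedGE := (l.parts.pairwise_sort (· ≥ ·)).sortedGE
    have hpos : ∀ x ∈ l.parts.sort (· ≥ ·), 0 < x := fun x hx =>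
      l.parts_pos ((Multiset.mem_sort _).1 hx)
    have hr := YoungDiagram.rowLens_ofRowLens_eq_self (hw := hw) hpos
    refine ⟨⟨YoungDiagram.ofRowLens _ hw, ?_⟩, ?_⟩
    · rw [← sum_rowLens, hr, ← Multiset.sum_coe, Multiset.sort_eq, l.parts_sum]
    · ext1
      change ((YoungDiagram.ofRowLens _ hw).rowLens : Multiset ℕ) = _
      rw [hr, Multiset.sort_eq]

instance (n : ℕ) : Fintype {μ : YoungDiagram // μ.card = n} :=
  Fintype.ofEquiv _ (Equiv.ofBijective _ (rowPartition_bijective n)).symm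

theorem card_diagrams (n : ℕ) :
    Fintype.card {μ : YoungDiagram // μ.card = n} = Fintype.card n.Partition :=
  Fintype.card_of_bijective (rowPartition_bijective n)

/-! ### Restriction to permutations that fix a point -/

section
variable {α : Type*} [Fintype α] [DecidableEq α] {μ ν : YoungDiagram}

theorem exists_extend_tableau (c : corners μ) (U : α ≃ (eraseCorner μ c).cells) :
    ∃ T : Option α ≃ μ.cells, ∀ a, (T (some a)).1 = (U a).1 := by
  have hU : ∀ a, (U a).1 ∈ μ.cells := fun a => mem_of_mem_erase (U a).2
  have hUc : ∀ a, (U a).1 ≠ c.1 := fun a => ne_of_mem_erase (U a).2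
  let f : Option α → μ.cells := fun o => o.elim ⟨c.1, corner_mem c⟩ fun a => ⟨(U a).1, hU a⟩
  have hf : Function.Bijective f := by
    rw [Fintype.bijective_iff_injective_and_card]
    constructor
    · rintro (_ | a) (_ | b) h
      · rfl
      · exact absurd (congrArg Subtype.val h).symm (hUc b)
      · exact absurd (congrArg Subtype.val h) (hUc a)
      · exact congrArg some (U.injective (Subtype.ext (congrArg Subtype.val h :)))
    · rw [Fintype.card_option, Fintype.card_congr U, Fintype.card_coe, Fintype.card_coe]
      exact card_eraseCorner c
  exact ⟨Equiv.ofBijective f hf, fun a => rfl⟩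

/-- The row and column groups of `U` embed into those of `T`. After multiplication by the row
symmetrizer of `T` on the left, both factors of the smaller symmetrizer are absorbed up to nonzero
scalars, and a nonzero multiple of the square of the symmetrizer of `T` remains. -/
theorem mapDomain_youngSymmetrizer_mul_ne_zero (T : Option α ≃ μ.cells) (U : α ≃ ν.cells)
    (h : ∀ a, (T (some a)).1 = (U a).1) :
    mapDomainAlgHom ℂ ℂ optionPerm (youngSymmetrizer U) * colAntisymmetrizer T *
      youngSymmetrizer T ≠ 0 := by
  have hg : ∀ (f : ℕ × ℕ → ℕ) (σ : Equiv.Perm α), (∀ x, f (U (σ x)).1 = f (U x).1) →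
      ∀ x, f (T (optionPerm σ x)).1 = f (T x).1 := by
    rintro f σ hσ (_ | a)
    · rfl
    · rw [optionPerm_some, h, h, hσ]
  obtain ⟨r, hr0, hr⟩ : ∃ r : ℂ, r ≠ 0 ∧
      rowSymmetrizer T * mapDomainAlgHom ℂ ℂ optionPerm (rowSymmetrizer U) =
        r • rowSymmetrizer T := by
    refine ⟨(#{σ : Equiv.Perm α | ∀ x, (U (σ x)).1.1 = (U x).1.1} : ℂ), ?_, ?_⟩
    · rw [Nat.cast_ne_zero, Finset.card_ne_zero]
      exact ⟨1, by simp⟩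
    · nth_rw 2 [rowSymmetrizer]
      rw [map_sum, mul_sum, Nat.cast_smul_eq_nsmul, ← sum_const]
      refine sum_congr rfl fun σ hσ => ?_
      rw [mem_filter_univ] at hσ
      rw [mapDomainAlgHom_apply, mapDomain_single]
      exact rowSymmetrizer_mul_single T (hg Prod.fst σ hσ)
  obtain ⟨s, hs0, hs⟩ : ∃ s : ℂ, s ≠ 0 ∧
      mapDomainAlgHom ℂ ℂ optionPerm (colAntisymmetrizer U) * colAntisymmetrizer T =
        s • colAntisymmetrizer T := by
    refine ⟨(#{σ : Equiv.Perm α | ∀ x, (U (σ x)).1.2 = (U x).1.2} : ℂ), ?_, ?_⟩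
    · rw [Nat.cast_ne_zero, Finset.card_ne_zero]
      exact ⟨1, by simp⟩
    · rw [colAntisymmetrizer, map_sum, sum_mul, Nat.cast_smul_eq_nsmul, ← sum_const]
      refine sum_congr rfl fun σ hσ => ?_
      rw [mem_filter_univ] at hσ
      have hsg : sign (optionPerm σ) = sign σ := Equiv.optionCongr_sign σ
      have := single_mul_colAntisymmetrizer_of_col T (hg Prod.snd σ hσ)
      have hsm : (single (optionPerm σ) ((sign σ : ℤ) : ℂ) : MonoidAlgebra ℂ _) =
          ((sign σ : ℤ) : ℂ) • single (optionPerm σ) 1 := by rw [smul_single, smul_eq_mul, mul_one]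
      rw [mapDomainAlgHom_apply, mapDomain_single, hsm, smul_mul_assoc, this, hsg, smul_smul]
      rcases Int.units_eq_one_or (sign σ) with h | h <;> simp [h]
  intro h0
  have h1 := congrArg (rowSymmetrizer T * ·) h0
  simp only [mul_zero] at h1
  have h2 : rowSymmetrizer T * (mapDomainAlgHom ℂ ℂ optionPerm (youngSymmetrizer U) *
      colAntisymmetrizer T * youngSymmetrizer T) =
      (rowSymmetrizer T * mapDomainAlgHom ℂ ℂ optionPerm (rowSymmetrizer U)) *
        (mapDomainAlgHom ℂ ℂ optionPerm (colAntisymmetrizer U) * colAntisymmetrizer T) *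
        youngSymmetrizer T := by
    rw [youngSymmetrizer, map_mul]; simp only [mul_assoc]
  rw [h2, hr, hs, smul_mul_smul_comm, smul_mul_assoc, ← youngSymmetrizer,
    youngSymmetrizer_mul_self, smul_smul] at h1
  exact smul_ne_zero (mul_ne_zero (mul_ne_zero hr0 hs0) (symmetrizerScalar_ne_zero T))
    (youngSymmetrizer_ne_zero T) h1

end

/-! ### Inner products of class functions -/

/-- The invariant bilinear form on class functions of the symmetric group of degree `n`. -/
def classForm (n : ℕ) (f g : Multiset ℕ → ℂ) : ℂ :=
  (n.factorial : ℂ)⁻¹ * ∑ σ : Equiv.Perm (Fin n), f σ.partition.parts * g σ.partition.parts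

theorem sum_parts_congr {α : Type*} [Fintype α] [DecidableEq α] (n : ℕ) (h : Fintype.card α = n)
    (f : Multiset ℕ → ℂ) :
    ∑ σ : Equiv.Perm (Fin n), f σ.partition.parts = ∑ σ : Equiv.Perm α, f σ.partition.parts := by
  rw [← Equiv.sum_comp (Fintype.equivFinOfCardEq h).permCongr]
  simp only [parts_permCongr]

/-- A permutation and its inverse have the same cycle type, so the inverse in the general inner
product formula can be dropped. -/
theorem classForm_charAt {n : ℕ} {lam μ : YoungDiagram} (T : Fin n ≃ lam.cells)
    (U : Fin n ≃ μ.cells) : classForm n (charAt lam) (charAt μ) = (Module.finrank ℂ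
      (LinearMap.mulLeftRight ℂ (youngIdempotent T, youngIdempotent U)).range : ℂ) := by
  have hn : (n.factorial : ℂ) ≠ 0 := Nat.cast_ne_zero.2 n.factorial_ne_zero
  have key := sum_idemChar_mul_idemChar (MonoidHom.id _) (isIdempotentElem_youngIdempotent T)
    (isIdempotentElem_youngIdempotent U)
  simp only [MonoidHom.id_apply, ← charAt_eq_idemChar, parts_inv] at key
  rw [classForm, key, Fintype.card_perm, Fintype.card_fin, inv_mul_cancel_left₀ hn]
  have hid : mapDomainAlgHom ℂ ℂ (MonoidHom.id _) (youngIdempotent T) = youngIdempotent T := by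
    simp
  rw [hid]

theorem exists_tableau {n : ℕ} {μ : YoungDiagram} (h : μ.card = n) : Nonempty (Fin n ≃ μ.cells) :=
  ⟨Fintype.equivOfCardEq (by simpa using h.symm)⟩

theorem youngIdempotent_ne_zero {α : Type*} [Fintype α] [DecidableEq α] {μ : YoungDiagram}
    (T : α ≃ μ.cells) : youngIdempotent T ≠ 0 :=
  smul_ne_zero (inv_ne_zero (symmetrizerScalar_ne_zero T)) (youngSymmetrizer_ne_zero T)

theorem classForm_charAt_self {n : ℕ} {μ : YoungDiagram} (h : μ.card = n) :
    classForm n (charAt μ) (charAt μ) = 1 := by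
  obtain ⟨T⟩ := exists_tableau h
  rw [classForm_charAt T T, Nat.cast_eq_one]
  have hmem : youngIdempotent T ∈
      (LinearMap.mulLeftRight ℂ (youngIdempotent T, youngIdempotent T)).range :=
    ⟨1, by rw [LinearMap.mulLeftRight_apply, mul_one, isIdempotentElem_youngIdempotent T]⟩
  refine (finrank_eq_one_iff_of_nonzero' ⟨youngIdempotent T, hmem⟩ ?_).2 ?_
  · exact fun h => youngIdempotent_ne_zero T (congrArg Subtype.val h)
  · rintro ⟨_, x, rfl⟩
    obtain ⟨c, hc⟩ := youngSymmetrizer_mul_mul_self T x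
    refine ⟨(symmetrizerScalar T)⁻¹ * c, Subtype.ext ?_⟩
    change ((symmetrizerScalar T)⁻¹ * c) • youngIdempotent T =
      youngIdempotent T * x * youngIdempotent T
    simp only [youngIdempotent, smul_mul_assoc, mul_smul_comm, hc, smul_smul]
    congr 1; ring

theorem classForm_charAt_of_ne {n : ℕ} {lam μ : YoungDiagram} (hl : lam.card = n)
    (hm : μ.card = n) (h : lam ≠ μ) : classForm n (charAt lam) (charAt μ) = 0 := by
  obtain ⟨T⟩ := exists_tableau hl
  obtain ⟨U⟩ := exists_tableau hm
  have h0 : LinearMap.mulLeftRight ℂ (youngIdempotent T, youngIdempotent U) = 0 :=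
    LinearMap.ext fun x => by
      rw [LinearMap.mulLeftRight_apply, youngIdempotent, youngIdempotent, smul_mul_assoc,
        smul_mul_smul_comm, youngSymmetrizer_mul_mul_eq_zero h, smul_zero, LinearMap.zero_apply]
  rw [classForm_charAt T U, h0, LinearMap.range_zero, finrank_bot, Nat.cast_zero]

theorem classForm_charAt_cons_one {n : ℕ} {μ ν : YoungDiagram} (T : Option (Fin n) ≃ μ.cells)
    (U : Fin n ≃ ν.cells) : classForm n (charAt ν) (fun l => charAt μ (1 ::ₘ l)) =
      (Module.finrank ℂ (LinearMap.mulLeftRight ℂ (mapDomainAlgHom ℂ ℂ optionPerm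
        (youngIdempotent U), youngIdempotent T)).range : ℂ) := by
  have hn : (n.factorial : ℂ) ≠ 0 := Nat.cast_ne_zero.2 n.factorial_ne_zero
  have key := sum_idemChar_mul_idemChar optionPerm (isIdempotentElem_youngIdempotent U)
    (isIdempotentElem_youngIdempotent T)
  simp only [← charAt_eq_idemChar, parts_inv, parts_optionPerm] at key
  rw [classForm, key, Fintype.card_perm, Fintype.card_fin, inv_mul_cancel_left₀ hn]

theorem exists_classForm_eq_natCast {n : ℕ} {μ ν : YoungDiagram} (hm : μ.card = n + 1)
    (hn : ν.card = n) :
    ∃ m : ℕ, classForm n (charAt ν) (fun l => charAt μ (1 ::ₘ l)) = m := by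
  obtain ⟨U⟩ := exists_tableau hn
  obtain ⟨T⟩ : Nonempty (Option (Fin n) ≃ μ.cells) :=
    ⟨Fintype.equivOfCardEq (by simpa using hm.symm)⟩
  exact ⟨_, classForm_charAt_cons_one T U⟩

theorem classForm_eraseCorner_ne_zero {n : ℕ} {μ : YoungDiagram} (hm : μ.card = n + 1)
    (c : corners μ) :
    classForm n (charAt (eraseCorner μ c)) (fun l => charAt μ (1 ::ₘ l)) ≠ 0 := by
  obtain ⟨U⟩ := exists_tableau (n := n) (μ := eraseCorner μ c)
    (by have := card_eraseCorner c; lia)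
  obtain ⟨T, hT⟩ := exists_extend_tableau c U
  rw [classForm_charAt_cons_one T U, Nat.cast_ne_zero]
  intro h0
  rw [Submodule.finrank_eq_zero, LinearMap.range_eq_bot] at h0
  have h1 := LinearMap.congr_fun h0 (colAntisymmetrizer T)
  rw [LinearMap.mulLeftRight_apply, youngIdempotent, youngIdempotent, map_smul, smul_mul_assoc,
    smul_mul_smul_comm, LinearMap.zero_apply] at h1
  exact smul_ne_zero (mul_ne_zero (inv_ne_zero (symmetrizerScalar_ne_zero U))
    (inv_ne_zero (symmetrizerScalar_ne_zero T)))
    (mapDomain_youngSymmetrizer_mul_ne_zero T U hT) h1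

/-- Frobenius reciprocity: `l ↦ l.count 1 * f (l.erase 1)` is the class function induced from `f`,
and `l ↦ g (1 ::ₘ l)` is the restriction of `g`. -/
theorem classForm_induced (n : ℕ) (f g : Multiset ℕ → ℂ) :
    classForm (n + 1) (fun l => (l.count 1 : ℂ) * f (l.erase 1)) g =
      classForm n f fun l => g (1 ::ₘ l) := by
  have hn : (n.factorial : ℂ) ≠ 0 := Nat.cast_ne_zero.2 n.factorial_ne_zero
  have hn' : (n : ℂ) + 1 ≠ 0 := by exact_mod_cast Nat.succ_ne_zero n
  rw [classForm, sum_parts_congr (α := Option (Fin n)) (n + 1) (by simp)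
    (fun l => (l.count 1 : ℂ) * f (l.erase 1) * g l)]
  simp only [mul_assoc]
  have hc : (Fintype.card (Fin n) : ℂ) = n := by rw [Fintype.card_fin]
  rw [sum_count_one_mul (fun l => f (l.erase 1) * g l), classForm, hc, Nat.factorial_succ]
  simp only [Multiset.erase_cons_head]
  push_cast
  field_simp

section
variable {n : ℕ}

/-- The cycle type, fixed points included, of a permutation of `Fin n`. -/
def cyclePartition (σ : Equiv.Perm (Fin n)) : n.Partition where
  parts := σ.partition.parts
  parts_pos h := σ.partition.parts_pos h
  parts_sum := by rw [σ.partition.parts_sum, Fintype.card_fin]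

theorem classForm_comm (f g : Multiset ℕ → ℂ) : classForm n f g = classForm n g f := by
  simp only [classForm, mul_comm]

theorem classForm_congr {f f' : Multiset ℕ → ℂ} (g : Multiset ℕ → ℂ)
    (h : ∀ l : n.Partition, f l.parts = f' l.parts) : classForm n f g = classForm n f' g := by
  rw [classForm, classForm]
  congr 1
  exact sum_congr rfl fun σ _ => congrArg (· * g σ.partition.parts) (h (cyclePartition σ))

theorem classForm_sum {ι : Type*} (s : Finset ι) (c : ι → ℂ) (f : ι → Multiset ℕ → ℂ)
    (g : Multiset ℕ → ℂ) : classForm n (fun l => ∑ i ∈ s, c i * f i l) g =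
      ∑ i ∈ s, c i * classForm n (f i) g := by
  simp only [classForm, sum_mul, mul_sum]
  rw [sum_comm]
  exact sum_congr rfl fun i _ => sum_congr rfl fun σ _ => by ring

theorem classForm_add (f f' g : Multiset ℕ → ℂ) :
    classForm n (fun l => f l + f' l) g = classForm n f g + classForm n f' g := by
  simp only [classForm, add_mul, sum_add_distrib, mul_add]

theorem classForm_sub (f f' g : Multiset ℕ → ℂ) :
    classForm n (fun l => f l - f' l) g = classForm n f g - classForm n f' g := by
  simp only [classForm, sub_mul, sum_sub_distrib, mul_sub]

/-- The irreducible characters span the class functions. -/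
theorem eq_zero_of_forall_classForm_eq_zero {f : Multiset ℕ → ℂ}
    (h : ∀ μ : YoungDiagram, μ.card = n → classForm n f (charAt μ) = 0) (l : n.Partition) :
    f l.parts = 0 := by
  let Ψ : (n.Partition → ℂ) →ₗ[ℂ] ({μ : YoungDiagram // μ.card = n} → ℂ) :=
    { toFun := fun h μ => (n.factorial : ℂ)⁻¹ * ∑ σ : Equiv.Perm (Fin n),
        h (cyclePartition σ) * charAt μ.1 σ.partition.parts
      map_add' := fun h h' => by
        ext μ; simp only [Pi.add_apply, add_mul, sum_add_distrib, mul_add]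
      map_smul' := fun c h => by
        ext μ
        simp only [Pi.smul_apply, smul_eq_mul, RingHom.id_apply, mul_sum]
        exact sum_congr rfl fun σ _ => by ring }
  have hΨ : ∀ (g : Multiset ℕ → ℂ) μ, Ψ (fun l => g l.parts) μ = classForm n g (charAt μ.1) :=
    fun g μ => rfl
  -- Orthonormality provides a preimage of every family of coefficients; injectivity follows since
  -- there are as many diagrams as partitions.
  have hsurj : Function.Surjective Ψ := by
    classical
    intro c
    refine ⟨fun l => ∑ μ : {μ : YoungDiagram // μ.card = n}, c μ * charAt μ.1 l.parts, ?_⟩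
    ext ν
    rw [hΨ (fun l => ∑ μ : {μ : YoungDiagram // μ.card = n}, c μ * charAt μ.1 l), classForm_sum,
      sum_eq_single ν]
    · rw [classForm_charAt_self ν.2, mul_one]
    · intro μ _ hne
      rw [classForm_charAt_of_ne μ.2 ν.2 fun h => hne (Subtype.ext h), mul_zero]
    · simp
  have hinj : Function.Injective Ψ := by
    refine (LinearMap.injective_iff_surjective_of_finrank_eq_finrank ?_).2 hsurj
    rw [Module.finrank_fintype_fun_eq_card, Module.finrank_fintype_fun_eq_card, card_diagrams]
  have h0 : Ψ (fun l => f l.parts) = 0 := by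
    ext μ
    rw [hΨ, h μ.1 μ.2]; rfl
  exact congrFun (hinj (h0.trans (map_zero Ψ).symm)) l

/-- Parseval's identity for the orthonormal basis of irreducible characters. -/
theorem classForm_self (f : Multiset ℕ → ℂ) : classForm n f f =
    ∑ μ : {μ : YoungDiagram // μ.card = n}, classForm n f (charAt μ.1) ^ 2 := by
  classical
  set c : {μ : YoungDiagram // μ.card = n} → ℂ := fun μ => classForm n f (charAt μ.1) with hc
  have h : ∀ l : n.Partition, f l.parts = ∑ μ, c μ * charAt μ.1 l.parts := by
    intro l
    rw [← sub_eq_zero]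
    refine eq_zero_of_forall_classForm_eq_zero
      (f := fun l => f l - ∑ μ, c μ * charAt μ.1 l) (fun ν hν => ?_) l
    rw [classForm_sub, classForm_sum, sum_eq_single ⟨ν, hν⟩]
    · rw [classForm_charAt_self hν, mul_one, sub_self]
    · intro μ _ hne
      rw [classForm_charAt_of_ne μ.2 hν fun h => hne (Subtype.ext h), mul_zero]
    · simp
  rw [classForm_congr (f' := fun l => ∑ μ, c μ * charAt μ.1 l) f h, classForm_sum]
  refine sum_congr rfl fun μ _ => ?_
  rw [classForm_comm, pow_two]

end

/-! ### The branching rule -/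

/-- The branching rule for the restriction of the irreducible characters to the symmetric group of
degree `n`. -/
def BranchingRule (n : ℕ) : Prop :=
  ∀ μ : YoungDiagram, μ.card = n + 1 → ∀ l : n.Partition,
    charAt μ (1 ::ₘ l.parts) = ∑ c : corners μ, charAt (eraseCorner μ c) l.parts

theorem classForm_sum_eraseCorner {n : ℕ} {μ ν : YoungDiagram} (hm : μ.card = n + 1)
    (hn : ν.card = n) [Decidable (∃ c, eraseCorner μ c = ν)] :
    classForm n (fun l => ∑ c : corners μ, charAt (eraseCorner μ c) l) (charAt ν) =
      if ∃ c, eraseCorner μ c = ν then 1 else 0 := by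
  have hc : ∀ c : corners μ, (eraseCorner μ c).card = n := fun c => by
    have := card_eraseCorner c; lia
  have := classForm_sum (n := n) univ (fun _ => 1) (fun c : corners μ => charAt (eraseCorner μ c))
    (charAt ν)
  simp only [one_mul] at this
  rw [this]
  split_ifs with h
  · obtain ⟨c, rfl⟩ := h
    rw [sum_eq_single c, classForm_charAt_self (hc c)]
    · intro d _ hne
      exact classForm_charAt_of_ne (hc d) (hc c) fun h => hne (eraseCorner_injective μ h)
    · simp
  · exact sum_eq_zero fun c _ => classForm_charAt_of_ne (hc c) hn fun hc => h ⟨c, hc⟩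

theorem classForm_restrict_self {n : ℕ} (hb : BranchingRule n) {μ : YoungDiagram}
    (hm : μ.card = n + 1) :
    classForm n (fun l => charAt μ (1 ::ₘ l)) (fun l => charAt μ (1 ::ₘ l)) = #(corners μ) := by
  classical
  rw [classForm_congr (f' := fun l => ∑ c : corners μ, charAt (eraseCorner μ c) l) _ (hb μ hm),
    classForm_comm,
    classForm_congr (f' := fun l => ∑ c : corners μ, charAt (eraseCorner μ c) l) _ (hb μ hm)]
  have := classForm_sum (n := n) univ (fun _ => 1) (fun c : corners μ => charAt (eraseCorner μ c))
    (fun l => ∑ c : corners μ, charAt (eraseCorner μ c) l)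
  simp only [one_mul] at this
  rw [this, sum_congr rfl fun c _ => ?_, sum_const, card_univ, Fintype.card_coe, nsmul_one]
  rw [classForm_comm, classForm_sum_eraseCorner hm (by have := card_eraseCorner c; lia),
    if_pos ⟨c, rfl⟩]

/-- By reciprocity and Parseval the left side is the norm of the induced character, that is, the
pairing of `χ_ν` with `Res Ind χ_ν = χ_ν + Ind Res χ_ν`. The second term contributes the norm of
`Res χ_ν`, known from the branching rule one degree lower. -/
theorem sum_classForm_sq {n : ℕ} (hb : ∀ k, n = k + 1 → BranchingRule k) {ν : YoungDiagram}
    (hn : ν.card = n) :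
    ∑ μ : {μ : YoungDiagram // μ.card = n + 1},
      classForm n (charAt ν) (fun l => charAt μ.1 (1 ::ₘ l)) ^ 2 = 1 + #(corners ν) := by
  simp only [← classForm_induced]
  rw [← classForm_self, classForm_induced]
  simp only [Multiset.erase_cons_head, Multiset.count_cons_self]
  have h1 : classForm n (charAt ν) (fun l => ((l.count 1 + 1 : ℕ) : ℂ) * charAt ν l) =
      classForm n (charAt ν) (charAt ν) +
        classForm n (fun l => (l.count 1 : ℂ) * charAt ν l) (charAt ν) := by
    rw [classForm_comm, add_comm, ← classForm_add]
    congr 1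
    ext l
    push_cast; ring
  rw [h1, classForm_charAt_self hn]
  congr 1
  cases n with
  | zero =>
    have h2 : corners ν = ∅ := by
      rw [Finset.eq_empty_iff_forall_notMem]
      intro c hc
      have := corner_mem ⟨c, hc⟩
      rw [Finset.card_eq_zero.1 hn] at this
      simp at this
    rw [h2, classForm_congr (f' := fun _ => 0) _ fun l => ?_]
    · simp [classForm]
    · simp
  | succ k =>
    rw [← classForm_restrict_self (hb k rfl) hn, ← classForm_induced]
    congr 1
    ext l
    by_cases h : 1 ∈ l
    · rw [Multiset.cons_erase h]
    · rw [Multiset.count_eq_zero_of_notMem h]; simp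

/-- The multiplicities are natural numbers, at least `1` on the diagrams covering `ν`. There are at
least `1 + #(corners ν)` such diagrams, while the squares of all multiplicities add up to exactly
this number, so no slack is left anywhere. -/
theorem classForm_restrict {n : ℕ} (hb : ∀ k, n = k + 1 → BranchingRule k) {μ ν : YoungDiagram}
    (hm : μ.card = n + 1) (hn : ν.card = n) [Decidable (∃ c, eraseCorner μ c = ν)] :
    classForm n (charAt ν) (fun l => charAt μ (1 ::ₘ l)) =
      if ∃ c, eraseCorner μ c = ν then 1 else 0 := by
  classical
  choose m hmu using fun μ : {μ : YoungDiagram // μ.card = n + 1} =>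
    exists_classForm_eq_natCast μ.2 hn
  have hsum : ∑ μ, m μ ^ 2 = 1 + #(corners ν) := by
    have := sum_classForm_sq hb hn
    simp only [hmu] at this
    exact_mod_cast this
  set up : Finset {μ : YoungDiagram // μ.card = n + 1} :=
    {μ | ∃ c, eraseCorner μ.1 c = ν} with hup
  have hpos : ∀ μ ∈ up, 1 ≤ m μ := by
    intro μ hμ
    obtain ⟨c, hc⟩ := (mem_filter_univ _).1 hμ
    have := classForm_eraseCorner_ne_zero μ.2 c
    rw [hc, hmu, Nat.cast_ne_zero] at this
    exact Nat.one_le_iff_ne_zero.2 this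
  have hcard : 1 + #(corners ν) ≤ #up := by
    obtain ⟨f, hf, hfe⟩ := exists_add_cell ν
    have hfc : ∀ o, (f o).card = n + 1 := fun o => by
      obtain ⟨c, hc⟩ := hfe o
      rw [← card_eraseCorner c, hc, hn]
    calc 1 + #(corners ν) = #(univ : Finset (Option (corners ν))) := by
          rw [card_univ, Fintype.card_option, Fintype.card_coe, add_comm]
      _ ≤ #up := card_le_card_of_injOn (fun o => ⟨f o, hfc o⟩)
          (fun o _ => (mem_filter_univ _).2 (hfe o))
          fun o _ o' _ h => hf (congrArg Subtype.val h)
  have hle : ∀ μ, (if μ ∈ up then 1 else 0) ≤ m μ ^ 2 := by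
    intro μ
    split_ifs with h
    · exact Nat.one_le_pow _ _ (hpos μ h)
    · exact Nat.zero_le _
  have hone : ∑ μ, (if μ ∈ up then 1 else 0) = #up := by simp
  have heq := (sum_eq_sum_iff_of_le fun μ _ => hle μ).1
    (le_antisymm (sum_le_sum fun μ _ => hle μ) (by rw [hsum, hone]; exact hcard))
  have key := heq ⟨μ, hm⟩ (mem_univ _)
  rw [hmu ⟨μ, hm⟩]
  have hiff : (⟨μ, hm⟩ : {μ : YoungDiagram // μ.card = n + 1}) ∈ up ↔
      ∃ c, eraseCorner μ c = ν := mem_filter_univ _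
  by_cases h : ∃ c, eraseCorner μ c = ν
  · rw [if_pos (hiff.2 h), eq_comm, Nat.pow_eq_one] at key
    rw [if_pos h, key.resolve_right two_ne_zero, Nat.cast_one]
  · rw [if_neg (mt hiff.1 h), eq_comm] at key
    rw [if_neg h, pow_eq_zero_iff two_ne_zero |>.1 key, Nat.cast_zero]

theorem branchingRule (n : ℕ) : BranchingRule n := by
  classical
  induction n using Nat.strong_induction_on with
  | _ n ih =>
    intro μ hm l
    rw [← sub_eq_zero]
    refine eq_zero_of_forall_classForm_eq_zero (f := fun l =>
      charAt μ (1 ::ₘ l) - ∑ c : corners μ, charAt (eraseCorner μ c) l) (fun ν hν => ?_) l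
    rw [classForm_sub, classForm_sum_eraseCorner hm hν, classForm_comm,
      classForm_restrict (fun k hk => ih k (by lia)) hm hν, sub_self]

/-! ### The sum of the transpositions -/

/-- `1` if two cells are in the same row, minus `1` if they are in the same column. -/
def cellPairing (p q : ℕ × ℕ) : ℂ := (if p.1 = q.1 then 1 else 0) - (if p.2 = q.2 then 1 else 0)

/-- Twice the sum of the contents of the cells. -/
def doubleContent (μ : YoungDiagram) : ℂ := ∑ p ∈ μ.cells, ∑ q ∈ μ.cells, cellPairing p q

theorem cellPairing_comm (p q : ℕ × ℕ) : cellPairing p q = cellPairing q p := by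
  simp [cellPairing, eq_comm]

theorem cellPairing_self (p : ℕ × ℕ) : cellPairing p p = 0 := by simp [cellPairing]

theorem sum_cellPairing (μ : YoungDiagram) (p : ℕ × ℕ) :
    ∑ q ∈ μ.cells, cellPairing p q = (μ.rowLen p.1 : ℂ) - μ.colLen p.2 := by
  simp only [cellPairing, sum_sub_distrib, sum_boole]
  rw [μ.rowLen_eq_card, μ.colLen_eq_card, YoungDiagram.row, YoungDiagram.col]
  simp only [eq_comm]

/-- The pairing is symmetric and vanishes on the diagonal, so a corner contributes twice its sum
against all cells, which is its row length minus its column length. -/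
theorem doubleContent_sub (μ : YoungDiagram) (c : corners μ) :
    doubleContent μ - doubleContent (eraseCorner μ c) =
      2 * ((μ.rowLen c.1.1 : ℂ) - (c.1.1 + 1)) := by
  have hc := corner_mem c
  have h0 := sum_cellPairing μ c.1
  rw [colLen_corner] at h0
  have h1 : doubleContent μ = ∑ q ∈ μ.cells, cellPairing c.1 q +
      ∑ p ∈ μ.cells.erase c.1, ∑ q ∈ μ.cells, cellPairing p q := (add_sum_erase _ _ hc).symm
  have h2 : ∀ p, ∑ q ∈ μ.cells, cellPairing p q = cellPairing p c.1 +
      ∑ q ∈ μ.cells.erase c.1, cellPairing p q := fun p => (add_sum_erase _ _ hc).symm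
  have h3 : ∑ p ∈ μ.cells.erase c.1, cellPairing p c.1 = ∑ q ∈ μ.cells, cellPairing c.1 q := by
    rw [h2 c.1, cellPairing_self, zero_add]
    exact sum_congr rfl fun p _ => cellPairing_comm _ _
  have h4 : ∑ p ∈ μ.cells.erase c.1, ∑ q ∈ μ.cells, cellPairing p q =
      ∑ q ∈ μ.cells, cellPairing c.1 q + doubleContent (eraseCorner μ c) := by
    rw [sum_congr rfl fun p _ => h2 p, sum_add_distrib, h3]; rfl
  rw [h1, h4, h0]
  push_cast; ring

section
variable {α : Type*} [Fintype α] [DecidableEq α] {μ : YoungDiagram}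

/-- The sum of the transpositions of all pairs of entries. -/
def swapSum (α : Type*) [Fintype α] [DecidableEq α] : MonoidAlgebra ℂ (Equiv.Perm α) :=
  ∑ x : α, ∑ y : α, single (Equiv.swap x y) 1

theorem swapSum_mul_single (g : Equiv.Perm α) :
    swapSum α * single g 1 = single g 1 * swapSum α := by
  simp only [swapSum, sum_mul, mul_sum, single_mul_single, one_mul]
  rw [← Equiv.sum_comp g]
  refine sum_congr rfl fun x _ => ?_
  rw [← Equiv.sum_comp g]
  refine sum_congr rfl fun y _ => ?_
  rw [Equiv.mul_swap_eq_swap_mul]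

theorem swapSum_mul (a : MonoidAlgebra ℂ (Equiv.Perm α)) : swapSum α * a = a * swapSum α := by
  induction a using MonoidAlgebra.induction_on with
  | of g => exact swapSum_mul_single g
  | add x y hx hy => rw [mul_add, add_mul, hx, hy]
  | smul c x hx => rw [mul_smul_comm, smul_mul_assoc, hx]

/-- Being central, the sum can be placed between the row and column symmetrizers, where each
transposition acts by a scalar. Ordered pairs count every transposition twice, hence the doubled
content; the diagonal pairs give the summand `Fintype.card α`. -/
theorem swapSum_mul_youngIdempotent (T : α ≃ μ.cells) :
    swapSum α * youngIdempotent T = (doubleContent μ + Fintype.card α) • youngIdempotent T := by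
  have h : rowSymmetrizer T * swapSum α * colAntisymmetrizer T =
      (doubleContent μ + Fintype.card α) • youngSymmetrizer T := by
    have h1 : doubleContent μ = ∑ x, ∑ y, cellPairing (T x).1 (T y).1 := by
      rw [doubleContent, ← sum_tableau T]
      exact sum_congr rfl fun x _ => (sum_tableau T _).symm
    have h2 : (Fintype.card α : ℂ) = ∑ x : α, ∑ y : α, if x = y then 1 else 0 := by simp
    rw [h1, h2, ← sum_add_distrib, sum_smul, swapSum]
    simp only [mul_sum, sum_mul, ← sum_add_distrib, sum_smul,
      rowSymmetrizer_mul_swap_mul_colAntisymmetrizer]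
    rfl
  rw [youngIdempotent, mul_smul_comm, youngSymmetrizer, ← mul_assoc, swapSum_mul, h, smul_comm]
  rfl

theorem sum_charAt_swap_mul (T : α ≃ μ.cells) (g : Equiv.Perm α) :
    ∑ x : α, ∑ y : α, charAt μ (Equiv.swap x y * g).partition.parts =
      (doubleContent μ + Fintype.card α) * charAt μ g.partition.parts := by
  simp only [charAt_eq_idemChar T, idemChar, trace_mulLeftRight, single_mul_one]
  have h1 : ∀ h, ∑ x : α, ∑ y : α, (single (Equiv.swap x y) 1 * single g 1 * single h 1 *
      youngIdempotent T).coeff h = (doubleContent μ + Fintype.card α) *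
        (single g 1 * single h 1 * youngIdempotent T).coeff h := by
    intro h
    have h2 : swapSum α * (single g 1 * single h 1 * youngIdempotent T) =
        (doubleContent μ + Fintype.card α) • (single g 1 * single h 1 * youngIdempotent T) := by
      rw [← mul_assoc, swapSum_mul, mul_assoc, swapSum_mul_youngIdempotent, mul_smul_comm]
    have h3 := congrArg (fun a => a.coeff h) h2
    simp only [swapSum, sum_mul, coeff_sum, Finsupp.finsetSum_apply] at h3
    simpa [mul_assoc] using h3
  rw [mul_sum, ← sum_congr rfl fun h _ => h1 h]
  exact (sum_comm.trans (sum_congr rfl fun x _ => sum_comm)).symm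

end

/-- The sum over ordered pairs in `Option (Fin n)` splits into the pairs inside `Fin n`, the pair
`(none, none)`, and twice the sum on the right. The whole acts by a scalar on `χ_μ`, the pairs
inside by a scalar on each constituent of its restriction, and half the difference, corrected by the
diagonal pair, is the content of the erased corner. -/
theorem sum_content_mul_charAt {n : ℕ} {μ : YoungDiagram} (hm : μ.card = n + 1)
    (σ : Equiv.Perm (Fin n)) :
    ∑ c : corners μ, ((μ.rowLen c.1.1 : ℂ) - ((c.1.1 : ℂ) + 1)) *
        charAt (eraseCorner μ c) σ.partition.parts =
      ∑ a : Fin n, charAt μ (Equiv.swap none (some a) * optionPerm σ).partition.parts := by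
  obtain ⟨T⟩ : Nonempty (Option (Fin n) ≃ μ.cells) :=
    ⟨Fintype.equivOfCardEq (by simpa using hm.symm)⟩
  have hbr : ∀ τ : Equiv.Perm (Fin n), charAt μ (optionPerm τ).partition.parts =
      ∑ c : corners μ, charAt (eraseCorner μ c) τ.partition.parts := fun τ => by
    rw [parts_optionPerm]; exact branchingRule n μ hm (cyclePartition τ)
  have h1 := sum_charAt_swap_mul T (optionPerm σ)
  have hsw : ∀ x y : Fin n, Equiv.swap (some x) (some y) * optionPerm σ =
      optionPerm (Equiv.swap x y * σ) := fun x y => by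
    rw [map_mul]; congr 1; exact (Equiv.optionCongr_swap x y).symm
  simp only [Fintype.sum_option, Equiv.swap_comm (some _) none, hsw, hbr,
    sum_add_distrib] at h1
  have h2 : ∑ x : Fin n, ∑ y : Fin n, ∑ c : corners μ,
      charAt (eraseCorner μ c) (Equiv.swap x y * σ).partition.parts =
      ∑ c : corners μ, (doubleContent (eraseCorner μ c) + n) *
        charAt (eraseCorner μ c) σ.partition.parts := by
    rw [sum_congr rfl fun x _ => sum_comm, sum_comm]
    refine sum_congr rfl fun c _ => ?_
    obtain ⟨U⟩ := exists_tableau (n := n) (μ := eraseCorner μ c)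
      (by have := card_eraseCorner c; lia)
    have hcard : (Fintype.card (Fin n) : ℂ) = n := by rw [Fintype.card_fin]
    rw [sum_charAt_swap_mul U, hcard]
  have h3 : charAt μ (Equiv.swap none none * optionPerm σ).partition.parts =
      ∑ c : corners μ, charAt (eraseCorner μ c) σ.partition.parts := by
    rw [← hbr, Equiv.swap_self]; rfl
  have hcard : (Fintype.card (Option (Fin n)) : ℂ) = n + 1 := by simp
  rw [h2, h3, hcard] at h1
  have h4 : ∀ c : corners μ, ((μ.rowLen c.1.1 : ℂ) - ((c.1.1 : ℂ) + 1)) =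
      2⁻¹ * (doubleContent μ - doubleContent (eraseCorner μ c)) := fun c => by
    rw [doubleContent_sub]; ring
  simp only [h4, mul_assoc, sub_mul, ← mul_sum, sum_sub_distrib, add_mul, mul_sub,
    sum_add_distrib] at h1 ⊢
  linear_combination (-2⁻¹ : ℂ) * h1

theorem exists_parts_eq {n : ℕ} (l : n.Partition) :
    ∃ σ : Equiv.Perm (Fin n), σ.partition.parts = l.parts := by
  have hle : ∀ m ∈ l.parts.filter (fun i => ¬ 2 ≤ i), m = 1 := fun m hm => by
    rw [Multiset.mem_filter] at hm
    have := l.parts_pos hm.1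
    lia
  have hadd := Multiset.filter_add_not (fun i => 2 ≤ i) l.parts
  rw [Multiset.eq_replicate_card.2 hle] at hadd
  have hs := congrArg Multiset.sum hadd
  rw [Multiset.sum_add, Multiset.sum_replicate, l.parts_sum, smul_eq_mul, mul_one] at hs
  obtain ⟨σ, hσ⟩ := (exists_with_cycleType_iff (Fin n)
    (m := l.parts.filter fun i => 2 ≤ i)).2 ⟨by rw [Fintype.card_fin]; lia, fun a ha =>
      (Multiset.mem_filter.1 ha).2⟩
  refine ⟨σ, ?_⟩
  rw [parts_eq, hσ, Fintype.card_fin]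
  conv_rhs => rw [← hadd]
  congr 2
  lia

theorem sum_content_mul_charAt_partition {n : ℕ} {μ : YoungDiagram} (hm : μ.card = n + 1)
    (l : n.Partition) :
    ∑ c : corners μ, ((μ.rowLen c.1.1 : ℂ) - ((c.1.1 : ℂ) + 1)) *
        charAt (eraseCorner μ c) l.parts =
      (l.parts.map fun a : ℕ => (a : ℂ) * charAt μ ((a + 1) ::ₘ l.parts.erase a)).sum := by
  obtain ⟨σ, hσ⟩ := exists_parts_eq l
  rw [← hσ, sum_content_mul_charAt hm]
  have h1 : ∀ a : Fin n, (Equiv.swap none (some a) * optionPerm σ).partition.parts =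
      (cycleLen (optionPerm σ) (some a) + 1) ::ₘ
        σ.partition.parts.erase (cycleLen (optionPerm σ) (some a)) := fun a => by
    rw [parts_swap_mul rfl (by simp), parts_optionPerm, Multiset.erase_cons_head]
  simp only [h1]
  -- The sum is taken over all of `Option (Fin n)`; the term of the fixed point `none` then cancels
  -- against that of the additional part `1`.
  have h2 := sum_cycleLen (optionPerm σ)
    fun a => charAt μ ((a + 1) ::ₘ σ.partition.parts.erase a)
  rw [Fintype.sum_option, parts_optionPerm, Multiset.map_cons, Multiset.sum_cons, one_smul,
    show cycleLen (optionPerm σ) none = 1 from if_pos rfl] at h2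
  rw [add_left_cancel h2]
  simp only [nsmul_eq_mul]

/-! ### The operator `S` -/

theorem autCard_ne_zero (l : Multiset ℕ) : autCard l ≠ 0 :=
  prod_ne_zero_iff.2 fun _ _ => Nat.factorial_ne_zero _

theorem autCard_cons (a : ℕ) (l : Multiset ℕ) :
    autCard (a ::ₘ l) = (l.count a + 1) * autCard l := by
  have h1 : ∀ s : Finset ℕ, l.toFinset ⊆ s → autCard l = ∏ i ∈ s, (l.count i).factorial :=
    fun s hs => prod_subset hs fun i _ hi => by
      rw [Multiset.count_eq_zero_of_notMem (mt Multiset.mem_toFinset.2 hi), Nat.factorial_zero]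
  rw [h1 (insert a l.toFinset) (subset_insert _ _), autCard, Multiset.toFinset_cons,
    ← mul_prod_erase _ _ (mem_insert_self a l.toFinset),
    ← mul_prod_erase _ (fun i => (l.count i).factorial) (mem_insert_self a l.toFinset),
    Multiset.count_cons_self, Nat.factorial_succ, mul_assoc]
  congr 2
  refine prod_congr rfl fun i hi => ?_
  rw [Multiset.count_cons_of_ne (ne_of_mem_erase hi)]

/-- The monomial with the given multiset of indices. -/
def monom (l : Multiset ℕ) : MvPolynomial ℕ ℂ :=
  (l.map fun i => (MvPolynomial.X i : MvPolynomial ℕ ℂ)).prod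

theorem monom_cons (a : ℕ) (l : Multiset ℕ) : monom (a ::ₘ l) = MvPolynomial.X a * monom l := by
  simp [monom]

theorem pderiv_monom (i : ℕ) (l : Multiset ℕ) :
    MvPolynomial.pderiv i (monom l) = MvPolynomial.C (l.count i : ℂ) * monom (l.erase i) := by
  induction l using Multiset.induction_on with
  | empty => simp [monom]
  | cons a l ih =>
    rw [monom_cons, Derivation.leibniz, ih]
    by_cases h : a = i
    · subst h
      rw [MvPolynomial.pderiv_X_self, Multiset.erase_cons_head, Multiset.count_cons_self]
      by_cases hm : a ∈ l
      · have hml : monom l = MvPolynomial.X a * monom (l.erase a) := by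
          rw [← monom_cons, Multiset.cons_erase hm]
        rw [hml]
        simp only [smul_eq_mul]
        push_cast
        rw [map_add, map_one]
        ring
      · rw [Multiset.count_eq_zero_of_notMem hm]; simp
    · rw [MvPolynomial.pderiv_X_of_ne h, Multiset.count_cons_of_ne (Ne.symm h),
        Multiset.erase_cons_tail _ h, monom_cons]
      simp only [smul_eq_mul]; ring

theorem S_sum {ι : Type*} (s : Finset ι) (P : ι → MvPolynomial ℕ ℂ) :
    S (∑ i ∈ s, P i) = ∑ i ∈ s, S (P i) := by
  rw [S]
  simp only [map_sum, mul_sum]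
  exact finsum_sum_comm _ _ fun i _ => S_support_finite (P i)

theorem S_eq_sum {N : ℕ} (P : MvPolynomial ℕ ℂ)
    (h : ∀ i, N ≤ i → MvPolynomial.pderiv (i + 1) P = 0) :
    S P = ∑ i ∈ range N,
      MvPolynomial.C (i : ℂ) * MvPolynomial.X i * MvPolynomial.pderiv (i + 1) P := by
  refine finsum_eq_sum_of_support_subset _ fun i hi => ?_
  rw [mem_coe, mem_range]
  by_contra hn
  exact hi (by simp [h i (not_lt.1 hn)])

/-- The partition obtained by replacing a part. -/
def replacePart {m m' : ℕ} (l : m.Partition) {a b : ℕ} (ha : a ∈ l.parts) (hb : 0 < b)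
    (h : m' + a = m + b) : m'.Partition where
  parts := b ::ₘ l.parts.erase a
  parts_pos {i} hi := by
    rcases Multiset.mem_cons.1 hi with rfl | hi
    · exact hb
    · exact l.parts_pos (Multiset.mem_of_mem_erase hi)
  parts_sum := by
    have := Multiset.sum_erase ha
    rw [l.parts_sum] at this
    rw [Multiset.sum_cons]
    lia

theorem sum_map_parts {n : ℕ} (l : n.Partition) (g : ℕ → ℂ) :
    (l.parts.map g).sum = ∑ i ∈ range (n + 1), (l.parts.count i : ℂ) * g i := by
  rw [Finset.sum_multiset_map_count]
  simp only [nsmul_eq_mul]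
  refine sum_subset (fun i hi => ?_) fun i _ hi => ?_
  · have := Multiset.le_sum_of_mem (Multiset.mem_toFinset.1 hi)
    rw [l.parts_sum] at this
    exact mem_range.2 (by lia)
  · rw [Multiset.count_eq_zero_of_notMem (mt Multiset.mem_toFinset.2 hi), Nat.cast_zero, zero_mul]

/-- The sum over the partitions with a marked part `i + 1` is rewritten as a sum over the
partitions with a marked part `i`. -/
theorem sum_count_div_autCard (n : ℕ) (f : Multiset ℕ → ℂ) :
    ∑ l : (n + 1).Partition, ∑ i ∈ range (n + 1),
      MvPolynomial.C (f l.parts / (autCard l.parts : ℂ)) * (MvPolynomial.C (i : ℂ) *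
        MvPolynomial.X i *
          (MvPolynomial.C (l.parts.count (i + 1) : ℂ) * monom (l.parts.erase (i + 1)))) =
    ∑ l : n.Partition, MvPolynomial.C ((l.parts.map fun a : ℕ =>
      (a : ℂ) * f ((a + 1) ::ₘ l.parts.erase a)).sum / (autCard l.parts : ℂ)) * monom l.parts := by
  simp only [sum_map_parts, sum_div, map_sum, sum_mul]
  rw [← sum_product', ← sum_product']
  -- Only pairs with an actual marked part matter. The condition `0 < i` keeps the replaced part
  -- positive, and the term for `i = 0` vanishes through its factor `i`.
  rw [← sum_filter_of_ne (p := fun x : (n + 1).Partition × ℕ => 0 < x.2 ∧ x.2 + 1 ∈ x.1.parts),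
    ← sum_filter_of_ne (s := univ ×ˢ range (n + 1))
      (p := fun x : n.Partition × ℕ => x.2 ∈ x.1.parts)]
  · refine sum_bij'
      (fun x hx => (replacePart (m' := n) x.1 (mem_filter.1 hx).2.2 (mem_filter.1 hx).2.1
        (by lia), x.2))
      (fun x hx => (replacePart (m' := n + 1) x.1 (mem_filter.1 hx).2 (Nat.succ_pos x.2)
        (by lia), x.2)) ?_ ?_ ?_ ?_ ?_
    · rintro ⟨l, i⟩ hx
      obtain ⟨h1, h2, h3⟩ := mem_filter.1 hx
      exact mem_filter.2 ⟨mem_product.2 ⟨mem_univ _, (mem_product.1 h1).2⟩,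
        Multiset.mem_cons_self _ _⟩
    · rintro ⟨l, i⟩ hx
      obtain ⟨h1, h2⟩ := mem_filter.1 hx
      exact mem_filter.2 ⟨mem_product.2 ⟨mem_univ _, (mem_product.1 h1).2⟩,
        l.parts_pos h2, Multiset.mem_cons_self _ _⟩
    · rintro ⟨l, i⟩ hx
      obtain ⟨h1, h2, h3⟩ := mem_filter.1 hx
      refine Prod.ext (Nat.Partition.ext ?_) rfl
      simp only [replacePart, Multiset.erase_cons_head]
      exact Multiset.cons_erase h3
    · rintro ⟨l, i⟩ hx
      obtain ⟨h1, h2⟩ := mem_filter.1 hx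
      refine Prod.ext (Nat.Partition.ext ?_) rfl
      simp only [replacePart, Multiset.erase_cons_head]
      exact Multiset.cons_erase h2
    · rintro ⟨l, i⟩ hx
      obtain ⟨h1, h2, h3⟩ := mem_filter.1 hx
      simp only [replacePart, Multiset.erase_cons_head] at h3 ⊢
      obtain ⟨r, hr⟩ := Multiset.exists_cons_of_mem h3
      rw [hr, Multiset.erase_cons_head, Multiset.count_cons_self, Multiset.count_cons_self,
        autCard_cons, autCard_cons, monom_cons]
      have hr0 : (autCard r : ℂ) ≠ 0 := Nat.cast_ne_zero.2 (autCard_ne_zero r)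
      have hc0 : ((r.count (i + 1) + 1 : ℕ) : ℂ) ≠ 0 := Nat.cast_ne_zero.2 (Nat.succ_ne_zero _)
      have hc1 : ((r.count i + 1 : ℕ) : ℂ) ≠ 0 := Nat.cast_ne_zero.2 (Nat.succ_ne_zero _)
      -- With `r` the partition without its marked part, the multiplicity of the marked part cancels
      -- against `autCard` on either side, leaving the common denominator `autCard r`.
      have key : f ((i + 1) ::ₘ r) / (((r.count (i + 1) + 1) * autCard r : ℕ) : ℂ) * i *
          ((r.count (i + 1) + 1 : ℕ) : ℂ) = ((r.count i + 1 : ℕ) : ℂ) *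
            (i * f ((i + 1) ::ₘ r)) / (((r.count i + 1) * autCard r : ℕ) : ℂ) := by
        rw [Nat.cast_mul, Nat.cast_mul]
        field_simp
      rw [← key, map_mul, map_mul]
      ring
  · rintro ⟨l, i⟩ _ h
    by_contra hn
    simp only at hn
    exact h (by simp [Multiset.count_eq_zero_of_notMem hn])
  · rintro ⟨l, i⟩ _ h
    refine ⟨Nat.pos_of_ne_zero fun hi => h (by simp only at hi; simp [hi]), ?_⟩
    by_contra hn
    simp only at hn
    exact h (by simp [Multiset.count_eq_zero_of_notMem hn])

theorem S_D_succ {n : ℕ} {μ : YoungDiagram} (hm : μ.card = n + 1) :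
    S (D μ) = ∑ l : n.Partition, MvPolynomial.C ((l.parts.map fun a : ℕ =>
      (a : ℂ) * charAt μ ((a + 1) ::ₘ l.parts.erase a)).sum / autCard l.parts) * monom l.parts := by
  rw [← sum_count_div_autCard n, D, hm, S_sum]
  refine sum_congr rfl fun l _ => ?_
  rw [S_eq_sum (N := n + 1)]
  · refine sum_congr rfl fun i _ => ?_
    rw [Derivation.leibniz]
    change _ * (_ • MvPolynomial.pderiv (i + 1) (monom l.parts) + _) = _
    rw [pderiv_monom, MvPolynomial.pderiv_C, smul_zero, add_zero, smul_eq_mul]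
    ring
  · intro i hi
    rw [Derivation.leibniz]
    change _ • MvPolynomial.pderiv (i + 1) (monom l.parts) + _ = _
    have : l.parts.count (i + 1) = 0 := by
      rw [Multiset.count_eq_zero]
      intro h
      have := Multiset.le_sum_of_mem h
      rw [l.parts_sum] at this
      lia
    rw [pderiv_monom, this]
    simp

theorem D_eq {n : ℕ} {μ : YoungDiagram} (hm : μ.card = n) : D μ = ∑ l : n.Partition,
    MvPolynomial.C (charAt μ l.parts / (autCard l.parts : ℂ)) * monom l.parts := by
  subst hm; rfl

theorem S_D {n : ℕ} {μ : YoungDiagram} (hm : μ.card = n + 1) :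
    S (D μ) = ∑ c : corners μ,
      MvPolynomial.C ((μ.rowLen c.1.1 : ℂ) - ((c.1.1 : ℂ) + 1)) * D (eraseCorner μ c) := by
  have hc : ∀ c : corners μ, (eraseCorner μ c).card = n := fun c => by
    have := card_eraseCorner c; lia
  rw [S_D_succ hm]
  simp only [fun c => D_eq (hc c), mul_sum]
  rw [sum_comm]
  refine sum_congr rfl fun l _ => ?_
  rw [← sum_content_mul_charAt_partition hm, sum_div, map_sum, sum_mul]
  refine sum_congr rfl fun c _ => ?_
  rw [← mul_assoc, ← map_mul, mul_div_assoc]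

theorem S_D_zero {μ : YoungDiagram} (hm : μ.card = 0) : S (D μ) = 0 := by
  rw [D_eq hm, S_sum]
  refine sum_eq_zero fun l _ => ?_
  have hl : l.parts = 0 := by rw [Subsingleton.elim l (Nat.Partition.indiscrete 0)]; simp
  rw [S_eq_sum (N := 0)]
  · simp
  · intro i _
    rw [hl]
    simp [monom]

end YoungHirota

end

/-- The sums over `c` run over the corners `(i, μ_i)` of `μ`; a corner is given by
its 0-based coordinates `c = (i - 1, μ_i - 1)`, so that `μ_i - i` is
`μ.rowLen c.1 - (c.1 + 1)`. -/
theorem proposition4p2 (μ : YoungDiagram) :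
    (YoungHirota.S (YoungHirota.D μ) =
      ∑ c : YoungHirota.corners μ,
        MvPolynomial.C ((μ.rowLen c.1.1 : ℂ) - ((c.1.1 : ℂ) + 1)) *
          YoungHirota.D (YoungHirota.eraseCorner μ c)) ∧
    (∀ n : ℕ, μ.card = n + 1 → ∀ l : n.Partition,
      ∑ c : YoungHirota.corners μ,
        ((μ.rowLen c.1.1 : ℂ) - ((c.1.1 : ℂ) + 1)) *
          YoungHirota.charAt (YoungHirota.eraseCorner μ c) l.parts =
      (l.parts.map fun a : ℕ =>
        (a : ℂ) * YoungHirota.charAt μ ((a + 1) ::ₘ l.parts.erase a)).sum) := by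
  refine ⟨?_, fun n hm l => YoungHirota.sum_content_mul_charAt_partition hm l⟩
  rcases Nat.eq_zero_or_eq_succ_pred μ.card with hm | hm
  · rw [YoungHirota.S_D_zero hm]
    refine (Finset.sum_eq_zero fun c _ => ?_).symm
    exact absurd (YoungHirota.card_eraseCorner c) (by lia)
  · exact YoungHirota.S_D hm
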